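/- **Theorem.** Let $N\ge 1$ and let $W$ be an $N\times N$ weight matrix supported on a nonempty interval $(x_0,x_1)$, $-\infty\le x_0<x_1\le\infty$, that is, a function $W:\mathbb R\to M_N(\mathbb C)$ with Hermitian values which is identically zero outside $(x_0,x_1)$, entrywise smooth and positive definite on $(x_0,x_1)$, and has finite moments: the entries of $x^mW(x)$ are integrable on $\mathbb R$ for every integer $m\ge 0$. Put $\langle P,Q\rangle_W=\int_{\mathbb R}P(x)W(x)Q(x)^*\,dx\in M_N(\mathbb C)$ for matrix polynomials $P,Q\in M_N(\mathbb C[x])$, and let $P(x,n)$, $n\ge 0$, be the associated sequence of monic orthogonal matrix polynomials: $P(x,n)$ has degree $n$ and leading coefficient $I$, and $\langle P(x,n),P(x,m)\rangle_W=0$ for $m\ne n$. Let $\mathcal D(W)$ be the $\mathbb C$-algebra of all matrix differential operators $\mathfrak D=\sum_{j=0}^{\ell}\partial_x^jA_j(x)$ with $A_j\in M_N(\mathbb C[x])$, acting on the right by $F\cdot\mathfrak D=\sum_{j=0}^{\ell}F^{(j)}(x)A_j(x)$, such that for every $n\ge 0$ there is a matrix $\Lambda(n)\in M_N(\mathbb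 C)$ with $P(x,n)\cdot\mathfrak D=\Lambda(n)P(x,n)$. Then the center $\mathcal Z(W)$ of $\mathcal D(W)$ is a Noetherian ring, is finitely generated as a $\mathbb C$-algebra, and has Krull dimension at most $1$. -/

import Mathlib

open Polynomial MeasureTheory
open scoped ComplexOrder ContDiff

namespace MatrixBochner

/-- `M_N(ℂ)`. -/
abbrev Mat (N : ℕ) : Type := Matrix (Fin N) (Fin N) ℂ

/-- `W` is a weight matrix supported on the (bounded or unbounded) interval `(x₀, x₁)`: it is
Hermitian, identically zero outside the interval, entrywise smooth and positive definite on it,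
and has finite moments. -/
structure IsWeightMatrix {N : ℕ} (W : ℝ → Mat N) (x₀ x₁ : EReal) : Prop where
  lt : x₀ < x₁
  isHermitian : ∀ x : ℝ, (W x).IsHermitian
  eq_zero : ∀ x : ℝ, ¬ (x₀ < (x : EReal) ∧ (x : EReal) < x₁) → W x = 0
  smooth : ∀ i j : Fin N,
    ContDiffOn ℝ ∞ (fun x : ℝ => W x i j) {x : ℝ | x₀ < (x : EReal) ∧ (x : EReal) < x₁}
  posDef : ∀ x : ℝ, x₀ < (x : EReal) → (x : EReal) < x₁ → (W x).PosDef
  moments : ∀ (m : ℕ) (i j : Fin N), Integrable (fun x : ℝ => (x : ℂ) ^ m * W x i j) volume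

/-- The value at the real number `x` of the matrix polynomial `P ∈ M_N(ℂ)[x] = M_N(ℂ[x])`. -/
noncomputable def evalReal {N : ℕ} (P : (Mat N)[X]) (x : ℝ) : Mat N :=
  P.eval (algebraMap ℂ (Mat N) (x : ℂ))

/-- The matrix-valued inner product `⟨P, Q⟩_W = ∫ P(x) W(x) Q(x)* dx`, integrated entrywise. -/
noncomputable def innerW {N : ℕ} (W : ℝ → Mat N) (P Q : (Mat N)[X]) : Mat N :=
  Matrix.of fun i j => ∫ x : ℝ, (evalReal P x * W x * (evalReal Q x).conjTranspose) i j

/-- `P` is the sequence of monic orthogonal matrix polynomials for `W`: `P n` has degree `n` and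
leading coefficient `I`, and `⟨P n, P m⟩_W = 0` for `m ≠ n`. -/
structure IsMonicOrthogonal {N : ℕ} (W : ℝ → Mat N) (P : ℕ → (Mat N)[X]) : Prop where
  natDegree_eq : ∀ n, (P n).natDegree = n
  monic : ∀ n, (P n).Monic
  orthogonal : ∀ n m, m ≠ n → innerW W (P n) (P m) = 0

/-- `ℂ`-linear operators on `M_N(ℂ[x])` acting on the right: the opposite of the usual
endomorphism algebra, so that `F · (𝔇₁ 𝔇₂) = (F · 𝔇₁) · 𝔇₂`. -/
abbrev RightOperator (N : ℕ) : Type := (Module.End ℂ (Mat N)[X])ᵐᵒᵖ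

/-- The right action `F · 𝔇`. -/
noncomputable def act {N : ℕ} (F : (Mat N)[X]) (D : RightOperator N) : (Mat N)[X] := D.unop F

/-- `D` is a matrix differential operator `𝔇 = ∑_{j ≤ ℓ} ∂ₓʲ A_j(x)` with polynomial coefficients
`A_j ∈ M_N(ℂ[x])`, acting by `F · 𝔇 = ∑_{j ≤ ℓ} F⁽ʲ⁾(x) A_j(x)`. The action on `M_N(ℂ[x])` is
faithful, so that the operator determines its coefficients. -/
def IsDifferentialOperator {N : ℕ} (D : RightOperator N) : Prop :=
  ∃ (l : ℕ) (A : ℕ → (Mat N)[X]), ∀ F : (Mat N)[X],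
    act F D = ∑ j ∈ Finset.range (l + 1), derivative^[j] F * A j

namespace IsDifferentialOperator

variable {N : ℕ}

theorem add {D E : RightOperator N} (hD : IsDifferentialOperator D)
    (hE : IsDifferentialOperator E) : IsDifferentialOperator (D + E) := by
  obtain ⟨l, A, hA⟩ := hD
  obtain ⟨m, B, hB⟩ := hE
  refine ⟨l + m, fun j => (if j < l + 1 then A j else 0) + (if j < m + 1 then B j else 0), ?_⟩
  intro F
  have h1 : ∑ j ∈ Finset.range (l + m + 1), derivative^[j] F * (if j < l + 1 then A j else 0)
      = ∑ j ∈ Finset.range (l + 1), derivative^[j] F * A j := by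
    rw [← Finset.sum_subset (Finset.range_mono (show l + 1 ≤ l + m + 1 by omega))]
    · exact Finset.sum_congr rfl fun j hj => by rw [if_pos (Finset.mem_range.1 hj)]
    · intro j _ hj
      rw [if_neg (by simpa using hj), mul_zero]
  have h2 : ∑ j ∈ Finset.range (l + m + 1), derivative^[j] F * (if j < m + 1 then B j else 0)
      = ∑ j ∈ Finset.range (m + 1), derivative^[j] F * B j := by
    rw [← Finset.sum_subset (Finset.range_mono (show m + 1 ≤ l + m + 1 by omega))]
    · exact Finset.sum_congr rfl fun j hj => by rw [if_pos (Finset.mem_range.1 hj)]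
    · intro j _ hj
      rw [if_neg (by simpa using hj), mul_zero]
  have h3 : act F (D + E) = act F D + act F E := rfl
  simp only [mul_add, Finset.sum_add_distrib, h1, h2, h3, hA, hB]

theorem of_algebraMap (c : ℂ) : IsDifferentialOperator (algebraMap ℂ (RightOperator N) c) := by
  refine ⟨0, fun _ => C (algebraMap ℂ (Mat N) c), fun F => ?_⟩
  have h : act F (algebraMap ℂ (RightOperator N) c) = c • F := rfl
  rw [h, Algebra.smul_def, Algebra.commutes]
  simp [Polynomial.algebraMap_apply]

theorem sum {ι : Type} (s : Finset ι) (D : ι → RightOperator N)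
    (h : ∀ i ∈ s, IsDifferentialOperator (D i)) : IsDifferentialOperator (∑ i ∈ s, D i) := by
  classical
  induction s using Finset.induction_on with
  | empty => simpa using of_algebraMap (N := N) 0
  | insert a s ha ih =>
    rw [Finset.sum_insert ha]
    exact (h a (by simp)).add (ih fun i hi => h i (by simp [hi]))

/-- The operator `F ↦ F⁽ʲ⁾ A`. -/
noncomputable def term (j : ℕ) (A : (Mat N)[X]) : RightOperator N :=
  MulOpposite.op
    ((LinearMap.mulRight ℂ A) ∘ₗ ((derivative (R := Mat N)).restrictScalars ℂ ^ j))

theorem act_term (j : ℕ) (A F : (Mat N)[X]) : act F (term j A) = derivative^[j] F * A := by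
  simp [act, term, Module.End.pow_apply]

theorem act_sum {ι : Type} (s : Finset ι) (D : ι → RightOperator N) (F : (Mat N)[X]) :
    act F (∑ i ∈ s, D i) = ∑ i ∈ s, act F (D i) := by
  simp [act, Finset.unop_sum]

theorem of_term (j : ℕ) (A : (Mat N)[X]) : IsDifferentialOperator (term j A) := by
  refine ⟨j, fun i => if i = j then A else 0, fun F => ?_⟩
  rw [act_term, Finset.sum_eq_single j]
  · simp
  · intro b _ hb
    simp [hb]
  · simp

theorem mul {D E : RightOperator N} (hD : IsDifferentialOperator D)
    (hE : IsDifferentialOperator E) : IsDifferentialOperator (D * E) := by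
  obtain ⟨l, A, hA⟩ := hD
  obtain ⟨m, B, hB⟩ := hE
  have key : D * E = ∑ k ∈ Finset.range (m + 1), ∑ j ∈ Finset.range (l + 1),
      ∑ i ∈ Finset.range k.succ,
        term (k - i + j) ((k.choose i) • (derivative^[i] (A j) * B k)) := by
    apply MulOpposite.unop_injective
    apply LinearMap.ext
    intro F
    have h : act F (D * E) = act (act F D) E := rfl
    change act F (D * E) = act F _
    rw [h, hB]
    simp only [act_sum, act_term, hA, iterate_derivative_sum, iterate_derivative_mul,
      Finset.sum_mul, ← Function.iterate_add_apply, smul_mul_assoc, mul_smul_comm, mul_assoc]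
  rw [key]
  exact sum _ _ fun k _ => sum _ _ fun j _ => sum _ _ fun i _ => of_term _ _

end IsDifferentialOperator

/-- The algebra `𝒟(W)` of all matrix differential operators for which the monic orthogonal
polynomials `P n` of `W` are eigenfunctions for all `n`: `P n · 𝔇 = Λ(n) P n` with matrices
`Λ(n) ∈ M_N(ℂ)`. (For a weight matrix the sequence `P` exists and is unique.) -/
noncomputable def algebraD {N : ℕ} (W : ℝ → Mat N) : Subalgebra ℂ (RightOperator N) where
  carrier := {D | IsDifferentialOperator D ∧
    ∀ P : ℕ → (Mat N)[X], IsMonicOrthogonal W P → ∀ n, ∃ L : Mat N, act (P n) D = C L * P n}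
  mul_mem' := by
    rintro D E ⟨hD, hD'⟩ ⟨hE, hE'⟩
    refine ⟨hD.mul hE, fun P hP n => ?_⟩
    obtain ⟨L, hL⟩ := hD' P hP n
    obtain ⟨M, hM⟩ := hE' P hP n
    obtain ⟨l, A, hA⟩ := hE
    refine ⟨L * M, ?_⟩
    have h : act (P n) (D * E) = act (act (P n) D) E := rfl
    have h2 : act (C L * P n) E = C L * act (P n) E := by
      simp only [hA, iterate_derivative_C_mul, Finset.mul_sum, mul_assoc]
    rw [h, hL, h2, hM, C_mul, mul_assoc]
  add_mem' := by
    rintro D E ⟨hD, hD'⟩ ⟨hE, hE'⟩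
    refine ⟨hD.add hE, fun P hP n => ?_⟩
    obtain ⟨L, hL⟩ := hD' P hP n
    obtain ⟨M, hM⟩ := hE' P hP n
    have h : act (P n) (D + E) = act (P n) D + act (P n) E := rfl
    exact ⟨L + M, by rw [h, hL, hM, C_add, add_mul]⟩
  algebraMap_mem' := by
    intro c
    refine ⟨IsDifferentialOperator.of_algebraMap c, fun P _ n => ⟨algebraMap ℂ (Mat N) c, ?_⟩⟩
    have h : act (P n) (algebraMap ℂ (RightOperator N) c) = c • P n := rfl
    rw [h, Algebra.smul_def, Polynomial.algebraMap_apply]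

/-- The center `𝒵(W)` of `𝒟(W)`, a commutative `ℂ`-algebra. -/
noncomputable abbrev centerZ {N : ℕ} (W : ℝ → Mat N) : Subalgebra ℂ (algebraD W) :=
  Subalgebra.center ℂ (algebraD W)

end MatrixBochner

/-!
An operator `D` in `𝒟(W)` acts on `P n` by an eigenvalue `Λ(n)`, and comparing leading coefficients
shows that `Λ` is polynomial in `n`. The map `D ↦ Λ` embeds `𝒟(W)`, and with it the center, into the
algebra of `N × N` matrices over `ℂ[n]` (`MatrixBochner.exists_injective_algHom_matrix`).

Commutative subalgebras of such a matrix algebra can fail to be Noetherian because of nilpotents,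
so positivity of the weight has to enter. It does so through the adjoint: the adjoint of `D` for the
inner product of `W` is again in `𝒟(W)` (`MatrixBochner.exists_adjoint_mem_algebraD`), by the
characterization of differential operators as the left linear operators whose iterated commutators
with `x` eventually vanish. A central operator commutes with its adjoint, and then definiteness of
the inner product excludes nilpotents: the center is reduced (`MatrixBochner.isReduced_centerZ`).

It remains to see that a reduced commutative `k`-subalgebra `A` of the matrices over `k[t]` is a
finite module over `k[f]` for some `f` in `A`; this gives all three assertions. Being reduced, `A`
embeds into the product of the residue fields of the finitely many minimal primes of the
commutative ring `A[t]`. These are function fields in one variable, in which the elements of `A` are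
integral over `k[t]`, so their poles lie among finitely many places at infinity
(`finite_valuationSubring_notMem`). A generic `f` in `A` has a pole wherever some element of `A`
does, hence all of `A` is integral over `k[f]` by the valuative criterion, and the integral closure
of `k[f]` in a function field is a finite module (`exists_aeval_finite`).
-/

/-! ### Subalgebras of function fields in one variable -/

section CurveSubalgebras
open scoped IntermediateField.algebraAdjoinAdjoin
variable {k L : Type*} [Field k] [Field L] [Algebra k L]

/-- A transcendental element of a function field in one variable generates a subfield of finite
index. -/
theorem finiteDimensional_adjoin_of_transcendental [Algebra.EssFiniteType k L]
    (htr : Algebra.trdeg k L ≤ 1) {f : L} (hf : Transcendental k f) :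
    FiniteDimensional (IntermediateField.adjoin k {f}) L := by
  have hai : AlgebraicIndependent k (fun i : Unit => f) :=
    algebraicIndependent_unique_type_iff.2 hf
  have hb : IsTranscendenceBasis k (fun i : Unit => f) :=
    hai.isTranscendenceBasis_of_lift_trdeg_le_of_finite (by simpa using htr)
  have hal : Algebra.IsAlgebraic (IntermediateField.adjoin k (Set.range (fun i : Unit => f))) L :=
    hb.isAlgebraic_field
  have hr : Set.range (fun i : Unit => f) = {f} := by simp
  rw [hr] at hal
  have : Algebra.EssFiniteType (IntermediateField.adjoin k {f}) L :=
    Algebra.EssFiniteType.of_comp k _ L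
  exact Algebra.finite_of_essFiniteType_of_isAlgebraic

instance isPrincipalIdealRing_adjoin_singleton (f : L) :
    IsPrincipalIdealRing (Algebra.adjoin k {f}) := by
  have h : Function.Surjective (Polynomial.aeval f : k[X] →ₐ[k] L).rangeRestrict :=
    AlgHom.rangeRestrict_surjective _
  rw [Algebra.adjoin_singleton_eq_range_aeval]
  exact IsPrincipalIdealRing.of_surjective _ h

theorem isDedekindDomain_integralClosure_adjoin [CharZero k] [Algebra.EssFiniteType k L]
    (htr : Algebra.trdeg k L ≤ 1) {f : L} (hf : Transcendental k f) :
    IsDedekindDomain (integralClosure (Algebra.adjoin k {f}) L) := by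
  have := finiteDimensional_adjoin_of_transcendental htr hf
  have : CharZero (IntermediateField.adjoin k {f}) :=
    charZero_of_injective_algebraMap (algebraMap k _).injective
  exact integralClosure.isDedekindDomain (Algebra.adjoin k {f}) (IntermediateField.adjoin k {f}) L

theorem isFractionRing_integralClosure_adjoin [Algebra.EssFiniteType k L]
    (htr : Algebra.trdeg k L ≤ 1) {f : L} (hf : Transcendental k f) :
    IsFractionRing (integralClosure (Algebra.adjoin k {f}) L) L := by
  have := finiteDimensional_adjoin_of_transcendental htr hf
  exact integralClosure.isFractionRing_of_finite_extension (IntermediateField.adjoin k {f}) L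

theorem finite_integralClosure_adjoin [CharZero k] [Algebra.EssFiniteType k L]
    (htr : Algebra.trdeg k L ≤ 1) {f : L} (hf : Transcendental k f) :
    Module.Finite (Algebra.adjoin k {f}) (integralClosure (Algebra.adjoin k {f}) L) := by
  have := finiteDimensional_adjoin_of_transcendental htr hf
  have : CharZero (IntermediateField.adjoin k {f}) :=
    charZero_of_injective_algebraMap (algebraMap k _).injective
  exact IsIntegralClosure.finite (Algebra.adjoin k {f}) (IntermediateField.adjoin k {f}) L _

/-- The localization of a Dedekind domain at a nonzero prime `P` is a valuation ring: each `x` in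
the fraction field, or its inverse, is a fraction whose denominator lies outside `P`. -/
theorem exists_div_or_inv_div {D L : Type*} [CommRing D] [IsDedekindDomain D] [Field L]
    [Algebra D L] [IsFractionRing D L] (P : Ideal D) [P.IsPrime] (hP : P ≠ ⊥) (x : L) :
    ∃ c s : D, s ∉ P ∧ (x * algebraMap D L s = algebraMap D L c ∨
      algebraMap D L s = x * algebraMap D L c) := by
  have := IsLocalization.AtPrime.isDiscreteValuationRing_of_dedekind_domain D hP
    (Localization.AtPrime P)
  have key : ∀ a b : D, algebraMap D (Localization.AtPrime P) a ∣ algebraMap D _ b →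
      ∃ c s : D, s ∉ P ∧ s * b = a * c := by
    rintro a b ⟨z, hz⟩
    obtain ⟨⟨c, s⟩, hcs⟩ := IsLocalization.surj P.primeCompl z
    refine ⟨c, s, s.2, ?_⟩
    apply IsLocalization.injective (Localization.AtPrime P) P.primeCompl_le_nonZeroDivisors
    simp only at hcs
    rw [map_mul, map_mul, hz, ← hcs]
    ring
  obtain ⟨⟨a, b⟩, hb⟩ := IsLocalization.surj (nonZeroDivisors D) x
  simp only at hb
  have hb0 : algebraMap D L b ≠ 0 := by
    simp
  rcases ValuationRing.dvd_total (algebraMap D (Localization.AtPrime P) a) (algebraMap D _ b)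
    with h | h
  · obtain ⟨c, s, hs, e⟩ := key _ _ h
    refine ⟨c, s, hs, Or.inr ?_⟩
    apply mul_right_cancel₀ hb0
    rw [← map_mul, e, map_mul, ← hb]
    ring
  · obtain ⟨c, s, hs, e⟩ := key _ _ h
    refine ⟨c, s, hs, Or.inl ?_⟩
    apply mul_right_cancel₀ hb0
    rw [mul_right_comm, hb, ← map_mul, ← map_mul, mul_comm a, e, mul_comm]

/-- A valuation ring containing a Dedekind domain `D` and centred at a nonzero prime `P` of `D` is
determined by `P`. The statement gives one of the two inclusions; the other one follows by
exchanging `V` and `V'`. -/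
theorem ValuationSubring.le_of_valuation_lt_one_iff {D L : Type*} [CommRing D]
    [IsDedekindDomain D] [Field L] [Algebra D L] [IsFractionRing D L] (P : Ideal D) [P.IsPrime]
    (hP : P ≠ ⊥) {V V' : ValuationSubring L}
    (hV' : ∀ d, algebraMap D L d ∈ V')
    (h : ∀ d, V.valuation (algebraMap D L d) < 1 ↔ d ∈ P)
    (h' : ∀ d, V'.valuation (algebraMap D L d) < 1 ↔ d ∈ P) : V ≤ V' := by
  have hu : ∀ d, d ∉ P → V'.valuation (algebraMap D L d) = 1 := fun d hd =>
    le_antisymm ((V'.valuation_le_one_iff _).2 (hV' d)) (not_lt.1 fun hlt => hd ((h' d).1 hlt))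
  intro x hx
  rw [← ValuationSubring.valuation_le_one_iff] at hx ⊢
  obtain ⟨c, s, hs, e | e⟩ := exists_div_or_inv_div (L := L) P hP x
  · have := congrArg V'.valuation e
    rw [map_mul, hu s hs, mul_one] at this
    rw [this]
    exact (V'.valuation_le_one_iff _).2 (hV' c)
  · have hc : c ∉ P := by
      intro hc
      apply hs
      rw [← h, e, map_mul]
      exact (mul_le_of_le_one_left' hx).trans_lt ((h c).2 hc)
    have := congrArg V'.valuation e
    rw [map_mul, hu s hs, hu c hc, mul_one] at this
    exact this.symm.le

theorem ValuationSubring.mem_of_isIntegral_adjoin (V : ValuationSubring L)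
    (hV : ∀ c, algebraMap k L c ∈ V) {s : Set L} (hs : ∀ x ∈ s, x ∈ V) {x : L}
    (hx : IsIntegral (Algebra.adjoin k s) x) : x ∈ V := by
  have : IsIntegrallyClosedIn V.toSubring L := inferInstanceAs (IsIntegrallyClosedIn V L)
  have hle : (integralClosure (Algebra.adjoin k s).toSubring L).toSubring ≤ V.toSubring := by
    rw [Subring.integralClosure_subring_le_iff]
    intro y hy
    have hy' : y ∈ Algebra.adjoin k s := hy
    clear hy
    induction hy' using Algebra.adjoin_induction with
    | mem x hx => exact hs x hx
    | algebraMap r => exact hV r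
    | add x y _ _ hx hy => exact V.toSubring.add_mem hx hy
    | mul x y _ _ hx hy => exact V.toSubring.mul_mem hx hy
  exact hle hx

/-- The valuative criterion of integrality over a `k`-subalgebra of a field. -/
theorem isIntegral_adjoin_of_forall_valuationSubring {s : Set L} {x : L}
    (h : ∀ V : ValuationSubring L, (∀ c, algebraMap k L c ∈ V) → (∀ y ∈ s, y ∈ V) → x ∈ V) :
    IsIntegral (Algebra.adjoin k s) x := by
  have hx : x ∈ ⨅ V : {V : ValuationSubring L // (Algebra.adjoin k s : Set L) ⊆ V.toSubring},
      V.1.toSubring := by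
    rw [Subring.mem_iInf]
    rintro ⟨V, hV⟩
    exact h V (fun c => hV (algebraMap_mem (Algebra.adjoin k s) c))
      (fun y hy => hV (Algebra.subset_adjoin hy))
  rw [iInf_valuationSubring_superset] at hx
  have hx' : IsIntegral (Subring.closure (Algebra.adjoin k s : Set L)) x := hx
  have hc : Subring.closure (Algebra.adjoin k s : Set L) = (Algebra.adjoin k s).toSubring :=
    Subring.closure_eq (Algebra.adjoin k s).toSubring
  rw [hc] at hx'
  exact hx'

/-- A function field in one variable has only finitely many places at infinity, that is, valuation
rings over the constants at which `t` has a pole. They are centred at the primes containing `t⁻¹` of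
the integral closure of `k[t⁻¹]`. -/
theorem finite_valuationSubring_notMem [CharZero k] [Algebra.EssFiniteType k L]
    (htr : Algebra.trdeg k L ≤ 1) {t : L} (ht : Transcendental k t) :
    {V : ValuationSubring L | (∀ c, algebraMap k L c ∈ V) ∧ t ∉ V}.Finite := by
  have ht0 : t ≠ 0 := fun h => ht (h ▸ isAlgebraic_zero)
  have hs : Transcendental k t⁻¹ := fun h => ht (by simpa using h.inv)
  let D := integralClosure (Algebra.adjoin k {t⁻¹}) L
  have : IsDedekindDomain D := isDedekindDomain_integralClosure_adjoin htr hs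
  have : IsFractionRing D L := isFractionRing_integralClosure_adjoin htr hs
  let s : D := ⟨t⁻¹, isIntegral_algebraMap (A := L)
    (x := (⟨t⁻¹, Algebra.self_mem_adjoin_singleton k _⟩ : Algebra.adjoin k {t⁻¹}))⟩
  have hs0 : s ≠ 0 := fun h => inv_ne_zero ht0 (congrArg Subtype.val h)
  have hD : ∀ V : ValuationSubring L, (∀ c, algebraMap k L c ∈ V) ∧ t ∉ V →
      ∀ d : D, algebraMap D L d ∈ V := by
    rintro V ⟨hV, htV⟩ ⟨d, hd⟩
    refine V.mem_of_isIntegral_adjoin hV ?_ hd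
    rintro _ rfl
    exact (V.mem_or_inv_mem t).resolve_left htV
  let p : {V : ValuationSubring L | (∀ c, algebraMap k L c ∈ V) ∧ t ∉ V} → Ideal D := fun V =>
    Ideal.comap (Subring.inclusion (S := D.toSubring) (T := V.1.toSubring)
      fun d hd => hD V.1 V.2 ⟨d, hd⟩)
      (IsLocalRing.maximalIdeal V.1)
  have hp : ∀ V d, V.1.valuation (algebraMap D L d) < 1 ↔ d ∈ p V := fun V d =>
    (V.1.valuation_lt_one_iff ⟨algebraMap D L d, hD V.1 V.2 d⟩).symm
  have hsp : ∀ V, s ∈ p V := by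
    intro V
    rw [← hp]
    have h1 : 1 < V.1.valuation t := not_le.1 fun h => V.2.2 ((V.1.valuation_le_one_iff _).1 h)
    change V.1.valuation t⁻¹ < 1
    rw [map_inv₀]
    exact inv_lt_one_of_one_lt₀ h1
  have hpp : ∀ V, (p V).IsPrime := fun V => Ideal.IsPrime.comap _
  have hp0 : ∀ V, p V ≠ ⊥ := fun V h => hs0 (by simpa [h] using hsp V)
  have hinj : Function.Injective p := by
    intro V V' h
    have := hpp V
    apply Subtype.ext
    apply le_antisymm
    · exact ValuationSubring.le_of_valuation_lt_one_iff (p V) (hp0 V) (hD _ V'.2)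
        (hp V) (fun d => by rw [hp, h])
    · exact ValuationSubring.le_of_valuation_lt_one_iff (p V) (hp0 V) (hD _ V.2)
        (fun d => by rw [hp, h]) (hp V)
  have hfin : {I : Ideal D | I ∣ Ideal.span {s}}.Finite := by
    have := UniqueFactorizationMonoid.fintypeSubtypeDvd (Ideal.span {s}) (by simpa using hs0)
    exact Finite.of_fintype {I : Ideal D // I ∣ Ideal.span {s}}
  have hfin2 : (Set.range p).Finite := hfin.subset (by
    rintro _ ⟨V, rfl⟩
    rw [Set.mem_ofPred_eq, Ideal.dvd_span_singleton]
    exact hsp V)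
  have : Finite (Set.range p) := hfin2
  exact Finite.of_injective (Set.rangeFactorization p) (Set.rangeFactorization_injective.2 hinj)


/-- Over an algebraically closed `k` the integral closure of `k[f]` is finite also when `f` is
algebraic, since it is then `k` itself. -/
theorem finite_integralClosure_adjoin_of_isAlgClosed [CharZero k] [IsAlgClosed k]
    [Algebra.EssFiniteType k L] (htr : Algebra.trdeg k L ≤ 1) (f : L) :
    Module.Finite (Algebra.adjoin k {f}) (integralClosure (Algebra.adjoin k {f}) L) := by
  by_cases hf : Transcendental k f
  · exact finite_integralClosure_adjoin htr hf
  rw [Transcendental, not_not] at hf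
  have hint : ∀ x : L, IsIntegral (Algebra.adjoin k {f}) x → ∃ c, algebraMap k L c = x := by
    intro x hx
    have h1 : Algebra.IsIntegral k (Algebra.adjoin k {f}) :=
      Algebra.IsIntegral.adjoin fun y hy => by
        rw [Set.mem_singleton_iff.1 hy]; exact hf.isIntegral
    have h2 : IsIntegral k x := isIntegral_trans x hx
    exact minpoly.mem_range_of_degree_eq_one k x
      (IsAlgClosed.degree_eq_one_of_irreducible k (minpoly.irreducible h2))
  refine ⟨⟨{1}, ?_⟩⟩
  rw [eq_top_iff]
  rintro ⟨x, hx⟩ -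
  obtain ⟨c, rfl⟩ := hint x hx
  rw [Finset.coe_singleton, Submodule.mem_span_singleton]
  exact ⟨algebraMap k _ c, Subtype.ext (by simp [Algebra.smul_def])⟩

/-- If every element of the image of `A` in the function field `L` is integral over `k[t]`, then for
a generic `f` in `A` the image of `A` is integral over `k[f]`: it is enough that `f` has a pole at
each of the finitely many places at infinity where some element of `A` has one, and each of these
conditions excludes a proper `k`-subspace of `A`. -/
theorem exists_finset_submodule_forall_isIntegral [CharZero k] [Algebra.EssFiniteType k L]
    (htr : Algebra.trdeg k L ≤ 1) {t : L} (ht : Transcendental k t) {A : Type*} [CommRing A]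
    [Algebra k A] (φ : A →ₐ[k] L) (hφ : ∀ a, IsIntegral (Algebra.adjoin k {t}) (φ a)) :
    ∃ S : Finset (Submodule k A), ⊤ ∉ S ∧
      ∀ f, (∀ p ∈ S, f ∉ p) → ∀ a, IsIntegral (Algebra.adjoin k {φ f}) (φ a) := by
  classical
  let W : (V : ValuationSubring L) → (∀ c, algebraMap k L c ∈ V) → Submodule k A := fun V hV =>
    { carrier := {a | φ a ∈ V}
      add_mem' := fun {a b} ha hb => by
        rw [Set.mem_ofPred_eq, map_add]; exact add_mem ha hb
      zero_mem' := by rw [Set.mem_ofPred_eq, map_zero]; exact zero_mem _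
      smul_mem' := fun c a ha => by
        rw [Set.mem_ofPred_eq, map_smul, Algebra.smul_def]; exact mul_mem (hV c) ha }
  have : Finite {V : ValuationSubring L | (∀ c, algebraMap k L c ∈ V) ∧ t ∉ V} :=
    finite_valuationSubring_notMem htr ht
  let S₀ : Set (Submodule k A) :=
    Set.range fun V : {V : ValuationSubring L | (∀ c, algebraMap k L c ∈ V) ∧ t ∉ V} =>
      W V.1 V.2.1
  have hS₀ : S₀.Finite := Set.finite_range _
  refine ⟨hS₀.toFinset.erase ⊤, by simp, fun f hf a => ?_⟩
  refine isIntegral_adjoin_of_forall_valuationSubring fun V hV hfV => ?_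
  -- If `t ∈ V`, everything integral over `k[t]` lies in `V`; otherwise `V` is a place at infinity,
  -- and `f ∈ V` is possible only if the image of `A` is contained in `V`.
  by_cases htV : t ∈ V
  · exact V.mem_of_isIntegral_adjoin hV (by simpa using htV) (hφ a)
  by_cases hW : W V hV = ⊤
  · exact (hW ▸ Submodule.mem_top : a ∈ W V hV)
  · refine absurd (hfV _ rfl) (hf (W V hV) ?_)
    rw [Finset.mem_erase, Set.Finite.mem_toFinset]
    exact ⟨hW, ⟨⟨V, hV, htV⟩, rfl⟩⟩

/-- An algebra embedded in a finite product of function fields in one variable, with all coordinates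
integral over `k[t i]`, is a finite module over `k[f]` for some `f`: a single generic `f` serves all
the factors, as a vector space over an infinite field is no finite union of proper subspaces. -/
theorem exists_aeval_finite [CharZero k] [IsAlgClosed k] {A : Type*} [CommRing A] [Algebra k A]
    {ι : Type*} [Finite ι] (L : ι → Type*) [∀ i, Field (L i)] [∀ i, Algebra k (L i)]
    [∀ i, Algebra.EssFiniteType k (L i)] (htr : ∀ i, Algebra.trdeg k (L i) ≤ 1) (t : ∀ i, L i)
    (ht : ∀ i, Transcendental k (t i)) (φ : ∀ i, A →ₐ[k] L i)
    (hφ : ∀ i a, IsIntegral (Algebra.adjoin k {t i}) (φ i a))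
    (hinj : ∀ a, (∀ i, φ i a = 0) → a = 0) :
    ∃ f : A, (aeval f : k[X] →ₐ[k] A).toRingHom.Finite := by
  classical
  cases nonempty_fintype ι
  choose S hS hf using fun i =>
    exists_finset_submodule_forall_isIntegral (htr i) (ht i) (φ i) (hφ i)
  have : Infinite k := IsAlgClosed.instInfinite
  obtain ⟨f, hfS⟩ : ∃ f : A, ∀ i, ∀ p ∈ S i, f ∉ p := by
    have h := Subspace.biUnion_ne_univ_of_top_notMem (s := Finset.univ.biUnion S)
      (by simpa using hS)
    rw [Ne, Set.eq_univ_iff_forall, not_forall] at h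
    obtain ⟨f, hf⟩ := h
    simp only [Set.mem_iUnion, Finset.mem_biUnion, Finset.mem_univ, true_and, not_exists] at hf
    exact ⟨f, fun i p hp hfp => hf p ⟨i, hp⟩ hfp⟩
  refine ⟨f, ?_⟩
  let C : ∀ i, Subalgebra k (L i) := fun i =>
    (integralClosure (Algebra.adjoin k {φ i f}) (L i)).restrictScalars k
  let ψ : ∀ i, A →ₐ[k] C i := fun i => (φ i).codRestrict (C i) fun a => hf i f (hfS i) a
  have hC : ∀ i, (aeval (ψ i f) : k[X] →ₐ[k] C i).toRingHom.Finite := by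
    intro i
    have h1 : (algebraMap (Algebra.adjoin k {φ i f})
        (integralClosure (Algebra.adjoin k {φ i f}) (L i))).Finite :=
      RingHom.finite_algebraMap.2 (finite_integralClosure_adjoin_of_isAlgClosed (htr i) _)
    have h2 : (aeval (⟨φ i f, Algebra.self_mem_adjoin_singleton k _⟩ :
        Algebra.adjoin k {φ i f}) : k[X] →ₐ[k] _).toRingHom.Finite := by
      apply RingHom.Finite.of_surjective
      rintro ⟨x, hx⟩
      rw [Algebra.adjoin_singleton_eq_range_aeval] at hx
      obtain ⟨q, rfl⟩ := hx
      refine ⟨q, Subtype.ext ?_⟩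
      exact (Polynomial.aeval_algHom_apply (Algebra.adjoin k {φ i f}).val _ q).symm
    have h3 : (aeval (ψ i f) : k[X] →ₐ[k] C i).toRingHom = (algebraMap (Algebra.adjoin k {φ i f})
        (integralClosure (Algebra.adjoin k {φ i f}) (L i))).comp
          (aeval (⟨φ i f, Algebra.self_mem_adjoin_singleton k _⟩ :
            Algebra.adjoin k {φ i f}) : k[X] →ₐ[k] _).toRingHom := by
      refine RingHom.ext fun q => Subtype.ext ?_
      change (C i).val (aeval (ψ i f) q) = (Algebra.adjoin k {φ i f}).val (aeval _ q)
      rw [← Polynomial.aeval_algHom_apply, ← Polynomial.aeval_algHom_apply]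
      rfl
    rw [h3]
    exact h1.comp h2
  let : Algebra k[X] A := (aeval f : k[X] →ₐ[k] A).toRingHom.toAlgebra
  let : ∀ i, Algebra k[X] (C i) := fun i => (aeval (ψ i f) : k[X] →ₐ[k] C i).toRingHom.toAlgebra
  have : ∀ i, Module.Finite k[X] (C i) := hC
  let Φ : A →ₗ[k[X]] ∀ i, C i :=
    { toFun := fun a i => ψ i a
      map_add' := fun a b => by ext i; simp
      map_smul' := fun q a => by
        funext i
        change ψ i (aeval f q * a) = aeval (ψ i f) q * ψ i a
        rw [map_mul, Polynomial.aeval_algHom_apply] }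
  have hΦ : Function.Injective Φ := by
    rw [← LinearMap.ker_eq_bot, LinearMap.ker_eq_bot']
    intro a ha
    exact hinj a fun i => congrArg Subtype.val (congrFun ha i)
  have : IsNoetherian k[X] A := isNoetherian_of_injective Φ hΦ
  exact (inferInstance : Module.Finite k[X] A)

end CurveSubalgebras

/-! ### Reduced subalgebras of finite algebras over a polynomial ring -/

section OrdersOverPolynomials
variable {k : Type*} [Field k]

theorem trdeg_le_one_of_isAlgebraic {L : Type*} [Field L] [Algebra k L] [Algebra k[X] L]
    [IsScalarTower k k[X] L] [FaithfulSMul k[X] L] [Algebra.IsAlgebraic k[X] L] :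
    Algebra.trdeg k L ≤ 1 := by
  have h := lift_trdeg_add_eq k k[X] L
  rw [Polynomial.trdeg_of_isDomain, trdeg_eq_zero] at h
  simpa using h.symm.le

/-- The product of function fields is provided by the residue fields of the minimal primes of `B`;
reducedness of `A` makes the map to it injective. -/
theorem exists_aeval_finite_of_finite_polynomial [CharZero k] [IsAlgClosed k]
    {B : Type*} [CommRing B] [Algebra k[X] B] [Algebra k B] [IsScalarTower k k[X] B]
    [Module.Finite k[X] B] [Module.IsTorsionFree k[X] B]
    {A : Type*} [CommRing A] [Algebra k A] [IsReduced A] (Λ : A →ₐ[k] B)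
    (hΛ : Function.Injective Λ) :
    ∃ f : A, (aeval f : k[X] →ₐ[k] A).toRingHom.Finite := by
  have : IsNoetherianRing B := isNoetherian_of_tower k[X] inferInstance
  have : Finite (minimalPrimes B) := minimalPrimes.finite_of_isNoetherianRing B
  have hprime : ∀ q : minimalPrimes B, q.1.IsPrime := fun q => q.2.1.1
  have : Algebra.FiniteType k B := Algebra.FiniteType.trans (S := k[X]) inferInstance inferInstance
  -- Elements of a minimal prime are zero divisors, and `B` is torsion-free over `k[X]`.
  have hcomap : ∀ (q : minimalPrimes B), Function.Injective (algebraMap k[X] (B ⧸ q.1)) := by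
    intro q
    rw [injective_iff_map_eq_zero]
    intro p hp
    by_contra hp0
    rw [IsScalarTower.algebraMap_apply k[X] B, Ideal.Quotient.algebraMap_eq,
      Ideal.Quotient.eq_zero_iff_mem] at hp
    refine notMem_nonZeroDivisors_of_mem_mem_minimalPrimes hp q.2 ?_
    rw [mem_nonZeroDivisors_iff_right]
    intro b hb
    rw [mul_comm, ← Algebra.smul_def] at hb
    exact (smul_eq_zero.1 hb).resolve_left hp0
  have hinj : ∀ (q : minimalPrimes B),
      Function.Injective (algebraMap k[X] (FractionRing (B ⧸ q.1))) := by
    intro q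
    rw [IsScalarTower.algebraMap_eq k[X] (B ⧸ q.1)]
    exact (IsFractionRing.injective (B ⧸ q.1) _).comp (hcomap q)
  have hfaith : ∀ (q : minimalPrimes B), FaithfulSMul k[X] (FractionRing (B ⧸ q.1)) := fun q =>
    (faithfulSMul_iff_algebraMap_injective _ _).2 (hinj q)
  have hfaith' : ∀ (q : minimalPrimes B), FaithfulSMul k[X] (B ⧸ q.1) := fun q =>
    (faithfulSMul_iff_algebraMap_injective _ _).2 (hcomap q)
  have halg : ∀ (q : minimalPrimes B), Algebra.IsAlgebraic k[X] (FractionRing (B ⧸ q.1)) := by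
    intro q
    have : Algebra.IsAlgebraic k[X] (B ⧸ q.1) := Algebra.IsIntegral.isAlgebraic
    have := IsLocalization.isAlgebraic (S := FractionRing (B ⧸ q.1)) (nonZeroDivisors (B ⧸ q.1))
    exact Algebra.IsAlgebraic.trans k[X] (B ⧸ q.1) _
  have hess : ∀ (q : minimalPrimes B), Algebra.EssFiniteType k (FractionRing (B ⧸ q.1)) := by
    intro q
    have := Algebra.EssFiniteType.of_isLocalization (FractionRing (B ⧸ q.1))
      (nonZeroDivisors (B ⧸ q.1))
    exact Algebra.EssFiniteType.comp k (B ⧸ q.1) _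
  refine exists_aeval_finite (fun q : minimalPrimes B => FractionRing (B ⧸ q.1))
    (fun q => trdeg_le_one_of_isAlgebraic) (fun q => algebraMap k[X] _ X) ?_
    (fun q => (Algebra.algHom k (B ⧸ q.1) _).comp ((Ideal.Quotient.mkₐ k q.1).comp Λ)) ?_ ?_
  · intro q
    exact (transcendental_algebraMap_iff (hinj q)).2 (Polynomial.transcendental_X k)
  · intro q a
    have h1 : IsIntegral k[X] (Λ a) := Algebra.IsIntegral.isIntegral _
    refine IsIntegral.map_of_comp_eq (aeval (⟨algebraMap k[X] _ X,
      Algebra.self_mem_adjoin_singleton k _⟩ : Algebra.adjoin k {algebraMap k[X]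
        (FractionRing (B ⧸ q.1)) X}) : k[X] →ₐ[k] _).toRingHom
      ((algebraMap (B ⧸ q.1) (FractionRing (B ⧸ q.1))).comp (Ideal.Quotient.mk q.1)) ?_ h1
    refine RingHom.ext fun p => ?_
    change (Algebra.adjoin k {algebraMap k[X] (FractionRing (B ⧸ q.1)) X}).val (aeval _ p) =
      algebraMap k[X] (FractionRing (B ⧸ q.1)) p
    rw [← Polynomial.aeval_algHom_apply]
    change aeval (algebraMap k[X] (FractionRing (B ⧸ q.1)) X) p = _
    rw [Polynomial.aeval_algebraMap_apply, Polynomial.aeval_X_left_apply]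
  · intro a ha
    have h1 : Λ a ∈ nilradical B := by
      rw [nilradical, ← Ideal.sInf_minimalPrimes, Ideal.mem_sInf]
      intro q hq
      rw [← Ideal.Quotient.eq_zero_iff_mem]
      have := hprime ⟨q, hq⟩
      exact IsFractionRing.injective (B ⧸ q) (FractionRing (B ⧸ q))
        ((ha ⟨q, hq⟩).trans (map_zero _).symm)
    have h2 : IsNilpotent a := (IsNilpotent.map_iff hΛ).1 h1
    exact h2.eq_zero

open scoped IsMulCommutative in
/-- The commutative case applies to the `k[X]`-subalgebra of `M` generated by the image of `A`. -/
theorem exists_aeval_finite_of_finite_polynomial_of_ring [CharZero k] [IsAlgClosed k]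
    {M : Type*} [Ring M] [Algebra k[X] M] [Algebra k M] [IsScalarTower k k[X] M]
    [Module.Finite k[X] M] [Module.IsTorsionFree k[X] M]
    {A : Type*} [CommRing A] [Algebra k A] [IsReduced A] (Λ : A →ₐ[k] M)
    (hΛ : Function.Injective Λ) :
    ∃ f : A, (aeval f : k[X] →ₐ[k] A).toRingHom.Finite := by
  have : IsMulCommutative (Algebra.adjoin k[X] (Set.range Λ)) :=
    Algebra.isMulCommutative_adjoin k[X] (by
      rintro _ ⟨a, rfl⟩ _ ⟨b, rfl⟩
      rw [← map_mul, mul_comm, map_mul])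
  have h1 : Module.Finite k[X] (Algebra.adjoin k[X] (Set.range Λ)) :=
    inferInstanceAs (Module.Finite k[X]
      (Subalgebra.toSubmodule (Algebra.adjoin k[X] (Set.range Λ))))
  have h2 : Module.IsTorsionFree k[X] (Algebra.adjoin k[X] (Set.range Λ)) :=
    inferInstanceAs (Module.IsTorsionFree k[X]
      (Subalgebra.toSubmodule (Algebra.adjoin k[X] (Set.range Λ))))
  have h3 : IsScalarTower k k[X] (Algebra.adjoin k[X] (Set.range Λ)) :=
    IsScalarTower.of_algebraMap_eq fun c => Subtype.ext (IsScalarTower.algebraMap_apply k k[X] M c)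
  have hmem : ∀ a, Λ a ∈ Algebra.adjoin k[X] (Set.range Λ) := fun a =>
    Algebra.subset_adjoin ⟨a, rfl⟩
  let Λ' : A →ₐ[k] Algebra.adjoin k[X] (Set.range Λ) :=
    { toFun := fun a => ⟨Λ a, hmem a⟩
      map_one' := Subtype.ext (map_one Λ)
      map_zero' := Subtype.ext (map_zero Λ)
      map_mul' := fun a b => Subtype.ext (map_mul Λ a b)
      map_add' := fun a b => Subtype.ext (map_add Λ a b)
      commutes' := fun c => Subtype.ext (Λ.commutes c) }
  have hΛ' : Function.Injective Λ' := fun a b h => hΛ (congrArg Subtype.val h)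
  exact exists_aeval_finite_of_finite_polynomial Λ' hΛ'

theorem ringKrullDim_le_one_of_aeval_finite {A : Type*} [CommRing A] [Algebra k A] {f : A}
    (hf : (aeval f : k[X] →ₐ[k] A).toRingHom.Finite) : ringKrullDim A ≤ 1 := by
  let : Algebra k[X] A := (aeval f : k[X] →ₐ[k] A).toRingHom.toAlgebra
  have : Module.Finite k[X] A := hf
  have h : ringKrullDim A ≤ ringKrullDim k[X] := by
    refine Order.krullDim_le_of_strictMono (PrimeSpectrum.comap (algebraMap k[X] A)) ?_
    intro p q hpq
    exact Ideal.IsIntegral.comap_lt_comap hpq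
  refine h.trans_eq ?_
  rw [Polynomial.ringKrullDim_of_isNoetherianRing]
  simp

theorem finiteType_of_aeval_finite {A : Type*} [CommRing A] [Algebra k A] {f : A}
    (hf : (aeval f : k[X] →ₐ[k] A).toRingHom.Finite) : Algebra.FiniteType k A := by
  let : Algebra k[X] A := (aeval f : k[X] →ₐ[k] A).toRingHom.toAlgebra
  have : Module.Finite k[X] A := hf
  have : IsScalarTower k k[X] A := IsScalarTower.of_algebraMap_eq fun c => by
    simp [RingHom.algebraMap_toAlgebra]
  exact Algebra.FiniteType.trans (S := k[X]) inferInstance inferInstance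

/-- A reduced commutative `k`-subalgebra of a finite torsion-free `k[X]`-algebra, such as a matrix
algebra over `k[X]`, is Noetherian, finitely generated and of dimension at most one. -/
theorem isNoetherianRing_and_finiteType_and_ringKrullDim_le_one [CharZero k] [IsAlgClosed k]
    {M : Type*} [Ring M] [Algebra k[X] M] [Algebra k M] [IsScalarTower k k[X] M]
    [Module.Finite k[X] M] [Module.IsTorsionFree k[X] M]
    {A : Type*} [s : CommSemiring A] [Algebra k A] [IsReduced A] (Λ : A →ₐ[k] M)
    (hΛ : Function.Injective Λ) :
    IsNoetherianRing A ∧ Algebra.FiniteType k A ∧ ringKrullDim A ≤ 1 := by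
  -- A commutative semiring that is an algebra over a field has negatives.
  obtain ⟨r, rfl⟩ : ∃ r : CommRing A, r.toCommSemiring = s :=
    ⟨{ Algebra.semiringToRing k (A := A), s with }, rfl⟩
  obtain ⟨f, hf⟩ := exists_aeval_finite_of_finite_polynomial_of_ring Λ hΛ
  have hft := finiteType_of_aeval_finite hf
  exact ⟨Algebra.FiniteType.isNoetherianRing k A, hft, ringKrullDim_le_one_of_aeval_finite hf⟩

end OrdersOverPolynomials

/-! ### The matrix-valued inner product of a weight -/

namespace MatrixBochner

variable {N : ℕ}

/-- The algebraic properties of the matrix-valued inner product of a weight: it is sesquilinear over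
`M_N(ℂ)` acting on the left, Hermitian and definite, and multiplication by `X` is symmetric. -/
structure IsPositiveMatrixForm (β : (Mat N)[X] → (Mat N)[X] → Mat N) : Prop where
  add_left : ∀ F G K, β (F + G) K = β F K + β G K
  C_mul_left : ∀ a F G, β (C a * F) G = a * β F G
  conj_symm : ∀ F G, (β F G).conjTranspose = β G F
  X_mul_left : ∀ F G, β (X * F) G = β F (X * G)
  definite : ∀ F, β F F = 0 → F = 0

/-- Evaluation at a real number as a ring homomorphism; it is multiplicative because the point is a
scalar matrix. -/
noncomputable def evalRealHom (N : ℕ) (x : ℝ) : (Mat N)[X] →+* Mat N :=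
  eval₂RingHom' (RingHom.id (Mat N)) (algebraMap ℂ (Mat N) (x : ℂ))
    fun a => (Algebra.commutes (x : ℂ) a).symm

theorem evalReal_eq_evalRealHom (F : (Mat N)[X]) (x : ℝ) : evalReal F x = evalRealHom N x F := rfl

theorem evalReal_add (F G : (Mat N)[X]) (x : ℝ) :
    evalReal (F + G) x = evalReal F x + evalReal G x := by
  simp only [evalReal_eq_evalRealHom, map_add]

theorem evalReal_mul (F G : (Mat N)[X]) (x : ℝ) :
    evalReal (F * G) x = evalReal F x * evalReal G x := by
  simp only [evalReal_eq_evalRealHom, map_mul]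

theorem evalReal_C (a : Mat N) (x : ℝ) : evalReal (C a) x = a := by
  simp [evalReal]

theorem evalReal_X (x : ℝ) : evalReal (X : (Mat N)[X]) x = algebraMap ℂ (Mat N) (x : ℂ) := by
  simp [evalReal]

theorem evalReal_monomial (m : ℕ) (a : Mat N) (x : ℝ) :
    evalReal (monomial m a) x = (x : ℂ) ^ m • a := by
  rw [evalReal, eval_monomial, ← map_pow, ← Algebra.commutes, Algebra.smul_def]

theorem eq_zero_of_infinite_evalReal_eq_zero {F : (Mat N)[X]}
    (h : {x : ℝ | evalReal F x = 0}.Infinite) : F = 0 := by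
  have key : ∀ i j, (∑ m ∈ F.support, monomial m (F.coeff m i j) : ℂ[X]) = 0 := by
    intro i j
    refine eq_zero_of_infinite_isRoot _
      (Set.Infinite.mono ?_ (h.image Complex.ofReal_injective.injOn))
    rintro _ ⟨x, hx, rfl⟩
    have hx' : evalReal F x i j = 0 := by
      rw [show evalReal F x = 0 from hx]; rfl
    rw [evalReal, eval_eq_sum, Polynomial.sum, Matrix.sum_apply] at hx'
    rw [Set.mem_ofPred_eq, IsRoot, eval_finsetSum, ← hx']
    refine Finset.sum_congr rfl fun m _ => ?_
    rw [← map_pow, ← Algebra.commutes, ← Algebra.smul_def, eval_monomial, Matrix.smul_apply,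
      smul_eq_mul, mul_comm]
  ext m i j
  have := congrArg (fun p => p.coeff m) (key i j)
  simp only [finsetSum_coeff, coeff_monomial, coeff_zero, Finset.sum_ite_eq'] at this
  by_cases hm : m ∈ F.support
  · simpa [hm] using this
  · rw [notMem_support_iff.1 hm, coeff_zero]

variable {W : ℝ → Mat N} {x₀ x₁ : EReal}

theorem integrable_evalReal (hW : IsWeightMatrix W x₀ x₁) (F G : (Mat N)[X]) (i j : Fin N) :
    Integrable (fun x : ℝ => (evalReal F x * W x * (evalReal G x).conjTranspose) i j) := by
  induction F using Polynomial.induction_on' with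
  | add F F' h h' =>
    simp only [evalReal_add, add_mul, Matrix.add_apply]
    exact h.add h'
  | monomial m a =>
    induction G using Polynomial.induction_on' with
    | add G G' h h' =>
      simp only [evalReal_add, Matrix.conjTranspose_add, mul_add, Matrix.add_apply]
      exact h.add h'
    | monomial n b =>
      have : ∀ x : ℝ, (evalReal (monomial m a) x * W x *
          (evalReal (monomial n b) x).conjTranspose) i j =
          ∑ l, ∑ k, a i k * ((x : ℂ) ^ (m + n) * W x k l) * star (b j l) := by
        intro x
        simp only [evalReal_monomial, Matrix.mul_apply, Matrix.smul_apply, Finset.sum_mul,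
          Matrix.conjTranspose_apply, smul_eq_mul, star_mul', star_pow, pow_add]
        refine Finset.sum_congr rfl fun l _ => Finset.sum_congr rfl fun k _ => ?_
        rw [show star (x : ℂ) = x from Complex.conj_ofReal x]
        ring
      simp only [this]
      exact integrable_finsetSum _ fun l _ => integrable_finsetSum _ fun k _ =>
        ((hW.moments (m + n) k l).const_mul _).mul_const _

theorem volume_pos_of_ereal_lt {x₀ x₁ : EReal} (h : x₀ < x₁) :
    0 < volume {x : ℝ | x₀ < (x : EReal) ∧ (x : EReal) < x₁} := by
  obtain ⟨q, h0, h1⟩ := EReal.lt_iff_exists_real_btwn.1 h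
  apply IsOpen.measure_pos
  · exact (isOpen_Ioo (a := x₀) (b := x₁)).preimage continuous_coe_real_ereal
  · exact ⟨q, h0, h1⟩

theorem isPositiveMatrixForm_innerW (hW : IsWeightMatrix W x₀ x₁) :
    IsPositiveMatrixForm (innerW W) where
  add_left F G K := by
    ext i j
    simp only [innerW, Matrix.of_apply, Matrix.add_apply, evalReal_add, add_mul]
    exact integral_add (integrable_evalReal hW F K i j) (integrable_evalReal hW G K i j)
  C_mul_left a F G := by
    ext i j
    simp only [innerW, Matrix.of_apply, evalReal_mul, evalReal_C, Matrix.mul_assoc]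
    simp only [Matrix.mul_apply (M := a), Matrix.of_apply, ← integral_const_mul]
    refine integral_finsetSum _ fun k _ => Integrable.const_mul ?_ _
    simpa only [Matrix.mul_assoc] using integrable_evalReal hW F G k j
  conj_symm F G := by
    ext i j
    simp only [innerW, Matrix.of_apply, Matrix.conjTranspose_apply]
    refine (integral_conj (f := fun x : ℝ =>
      (evalReal F x * W x * (evalReal G x).conjTranspose) j i)).symm.trans ?_
    refine integral_congr_ae (Filter.Eventually.of_forall fun x => ?_)
    have h : (evalReal F x * W x * (evalReal G x).conjTranspose).conjTranspose =
        evalReal G x * W x * (evalReal F x).conjTranspose := by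
      rw [Matrix.conjTranspose_mul, Matrix.conjTranspose_mul, Matrix.conjTranspose_conjTranspose,
        (hW.isHermitian x).eq, Matrix.mul_assoc]
    exact congrFun (congrFun h i) j
  X_mul_left F G := by
    ext i j
    simp only [innerW, Matrix.of_apply, evalReal_mul, evalReal_X, ← Algebra.smul_def,
      Matrix.conjTranspose_smul, Matrix.smul_mul, Matrix.mul_smul]
    simp only [show ∀ x : ℝ, star (x : ℂ) = x from fun x => Complex.conj_ofReal x]
  definite F hF := by
    set I : Set ℝ := {x : ℝ | x₀ < (x : EReal) ∧ (x : EReal) < x₁} with hI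
    have hsemi : ∀ x, (W x).PosSemidef := by
      intro x
      by_cases hx : x ∈ I
      · exact (hW.posDef x hx.1 hx.2).posSemidef
      · rw [hW.eq_zero x hx]; exact Matrix.PosSemidef.zero
    have hint : ∀ i, Integrable (fun x : ℝ =>
        ((evalReal F x * W x * (evalReal F x).conjTranspose) i i).re) := fun i =>
      (integrable_evalReal hW F F i i).re
    have hnn : ∀ x i, 0 ≤ (evalReal F x * W x * (evalReal F x).conjTranspose) i i := fun x i =>
      ((hsemi x).mul_mul_conjTranspose_same (evalReal F x)).diag_nonneg
    have hae : ∀ i, ∀ᵐ x : ℝ, ((evalReal F x * W x * (evalReal F x).conjTranspose) i i).re = 0 := by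
      intro i
      have h0 : ∫ x : ℝ, (evalReal F x * W x * (evalReal F x).conjTranspose) i i = 0 :=
        congrFun (congrFun hF i) i
      have h1 : ∫ x : ℝ, ((evalReal F x * W x * (evalReal F x).conjTranspose) i i).re = 0 := by
        have := integral_re (integrable_evalReal hW F F i i)
        rw [h0] at this
        simpa using this
      exact (integral_eq_zero_iff_of_nonneg (fun x => (Complex.le_def.1 (hnn x i)).1) (hint i)).1 h1
    rw [← ae_all_iff] at hae
    apply eq_zero_of_infinite_evalReal_eq_zero
    have hz : ∀ᵐ x : ℝ, x ∈ I → evalReal F x = 0 := by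
      filter_upwards [hae] with x hx hxI
      ext i l
      by_contra hne
      -- The diagonal entry `i` of `F W F*` is the value of `W` at the conjugate of row `i` of `F`.
      let v : Fin N → ℂ := fun l => star (evalReal F x i l)
      have hv : v ≠ 0 := fun h => hne (star_eq_zero.1 (congrFun h l))
      have hpos := (hW.posDef x hxI.1 hxI.2).dotProduct_mulVec_pos hv
      have hdiag : (evalReal F x * W x * (evalReal F x).conjTranspose) i i =
          star v ⬝ᵥ (W x).mulVec v := by
        rw [Matrix.mul_assoc, Matrix.mul_apply]
        simp only [v, dotProduct, Matrix.mulVec, Pi.star_apply, star_star, Matrix.mul_apply,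
          Matrix.conjTranspose_apply]
      rw [← hdiag, Complex.lt_def] at hpos
      exact hpos.1.ne' (hx i)
    intro hfin
    have h3 : volume {x : ℝ | evalReal F x = 0} = 0 := hfin.measure_zero volume
    have h4 : volume I = 0 := by
      have h5 : ∀ᵐ x : ℝ, x ∉ I := by
        filter_upwards [hz, measure_eq_zero_iff_ae_notMem.1 h3] with x h6 h7 h8
        exact h7 (h6 h8)
      exact measure_eq_zero_iff_ae_notMem.2 h5
    exact (volume_pos_of_ereal_lt hW.lt).ne' h4

end MatrixBochner

/-! ### Monic orthogonal matrix polynomials -/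

namespace MatrixBochner

variable {N : ℕ} {β : (Mat N)[X] → (Mat N)[X] → Mat N}

namespace IsPositiveMatrixForm

theorem zero_left (hβ : IsPositiveMatrixForm β) (G : (Mat N)[X]) : β 0 G = 0 := by
  simpa using hβ.C_mul_left 0 0 G

theorem add_right (hβ : IsPositiveMatrixForm β) (F G K : (Mat N)[X]) :
    β F (G + K) = β F G + β F K := by
  rw [← hβ.conj_symm, hβ.add_left, Matrix.conjTranspose_add, hβ.conj_symm, hβ.conj_symm]

theorem zero_right (hβ : IsPositiveMatrixForm β) (F : (Mat N)[X]) : β F 0 = 0 := by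
  rw [← hβ.conj_symm, hβ.zero_left, Matrix.conjTranspose_zero]

theorem C_mul_right (hβ : IsPositiveMatrixForm β) (a : Mat N) (F G : (Mat N)[X]) :
    β F (C a * G) = β F G * a.conjTranspose := by
  rw [← hβ.conj_symm, hβ.C_mul_left, Matrix.conjTranspose_mul, hβ.conj_symm]

theorem neg_left (hβ : IsPositiveMatrixForm β) (F G : (Mat N)[X]) : β (-F) G = -β F G := by
  rw [eq_neg_iff_add_eq_zero, ← hβ.add_left, neg_add_cancel, hβ.zero_left]

theorem sub_left (hβ : IsPositiveMatrixForm β) (F G K : (Mat N)[X]) :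
    β (F - G) K = β F K - β G K := by
  rw [sub_eq_add_neg, hβ.add_left, hβ.neg_left, sub_eq_add_neg]

theorem neg_right (hβ : IsPositiveMatrixForm β) (F G : (Mat N)[X]) : β F (-G) = -β F G := by
  rw [← hβ.conj_symm, hβ.neg_left, Matrix.conjTranspose_neg, hβ.conj_symm]

theorem sub_right (hβ : IsPositiveMatrixForm β) (F G K : (Mat N)[X]) :
    β F (G - K) = β F G - β F K := by
  rw [sub_eq_add_neg, hβ.add_right, hβ.neg_right, sub_eq_add_neg]

theorem sum_left (hβ : IsPositiveMatrixForm β) {ι : Type*} (s : Finset ι) (F : ι → (Mat N)[X])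
    (G : (Mat N)[X]) : β (∑ i ∈ s, F i) G = ∑ i ∈ s, β (F i) G :=
  map_sum (AddMonoidHom.mk' (fun F => β F G) fun F K => hβ.add_left F K G) F s

theorem eq_zero_of_forall_right (hβ : IsPositiveMatrixForm β) {F : (Mat N)[X]}
    (h : ∀ G, β F G = 0) : F = 0 := hβ.definite F (h F)

/-- If `v ⟨F, F⟩ = 0` for a row vector `v`, then the matrix `c` with all rows `v` satisfies
`⟨c F, c F⟩ = 0`, hence `c F = 0` and, `F` being monic, `c = 0`. -/
theorem isUnit_of_monic (hβ : IsPositiveMatrixForm β) {F : (Mat N)[X]} (hF : F.Monic) :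
    IsUnit (β F F) := by
  rw [Matrix.isUnit_iff_isUnit_det, isUnit_iff_ne_zero]
  intro hdet
  obtain ⟨v, hv, hvM⟩ := Matrix.exists_vecMul_eq_zero_iff.2 hdet
  let c : Mat N := Matrix.of fun _ => v
  have hc : c * β F F = 0 := by
    ext i j
    exact congrFun hvM j
  have hcF : C c * F = 0 := by
    apply hβ.definite
    rw [hβ.C_mul_left, hβ.C_mul_right, ← mul_assoc, hc, zero_mul]
  have hc0 : c = 0 := by
    have := congrArg (fun G => G.coeff F.natDegree) hcF
    simpa [coeff_C_mul, hF.coeff_natDegree] using this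
  apply hv
  cases isEmpty_or_nonempty (Fin N) with
  | inl h => exact Subsingleton.elim _ _
  | inr h => exact congrFun hc0 h.some

end IsPositiveMatrixForm

theorem degree_C_mul_lt {n : ℕ} (a : Mat N) {F : (Mat N)[X]} (hF : F.degree < n) :
    (C a * F).degree < n := by
  rw [degree_lt_iff_coeff_zero] at hF ⊢
  intro m hm
  rw [coeff_C_mul, hF m hm, mul_zero]

/-- Polynomials of degree less than `n` are left `M_N(ℂ)`-combinations of `P 0, …, P (n - 1)`, for
monic `P m` of degree `m`. -/
theorem degree_induction {P : ℕ → (Mat N)[X]} (hdeg : ∀ n, (P n).natDegree = n)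
    (hmon : ∀ n, (P n).Monic) {p : (Mat N)[X] → Prop} (n : ℕ) (h0 : p 0)
    (hadd : ∀ F G, p F → p G → p (F + G)) (hP : ∀ a m, m < n → p (C a * P m)) :
    ∀ F : (Mat N)[X], F.degree < n → p F := by
  induction n with
  | zero =>
    intro F hF
    rw [Nat.cast_zero, Nat.WithBot.lt_zero_iff, degree_eq_bot] at hF
    rwa [hF]
  | succ n ih =>
    intro F hF
    have hlow : (F - C (F.coeff n) * P n).degree < n := by
      rw [degree_lt_iff_coeff_zero]
      intro m hm
      rw [coeff_sub, coeff_C_mul]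
      rcases hm.eq_or_lt with rfl | hm
      · have := (hmon n).coeff_natDegree
        rw [hdeg] at this
        rw [this, mul_one, sub_self]
      · rw [coeff_eq_zero_of_natDegree_lt (p := P n) (by rw [hdeg]; exact hm), mul_zero, sub_zero]
        exact (degree_lt_iff_coeff_zero _ _).1 hF m hm
    rw [← sub_add_cancel F (C (F.coeff n) * P n)]
    exact hadd _ _ (ih (fun a m hm => hP a m (hm.trans n.lt_succ_self)) _ hlow)
      (hP _ n n.lt_succ_self)

theorem monic_basis_induction {P : ℕ → (Mat N)[X]} (hdeg : ∀ n, (P n).natDegree = n)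
    (hmon : ∀ n, (P n).Monic) {p : (Mat N)[X] → Prop} (h0 : p 0)
    (hadd : ∀ F G, p F → p G → p (F + G)) (hP : ∀ a m, p (C a * P m)) (F : (Mat N)[X]) : p F :=
  degree_induction hdeg hmon (F.natDegree + 1) h0 hadd (fun a m _ => hP a m) F
    (degree_le_natDegree.trans_lt (by exact_mod_cast Nat.lt_succ_self _))

/-- The monic orthogonal polynomials of a matrix-valued form, by the Gram–Schmidt process. -/
noncomputable def gramSchmidtPolynomial (β : (Mat N)[X] → (Mat N)[X] → Mat N) : ℕ → (Mat N)[X]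
  | n => X ^ n - ∑ k : Fin n, C (β (X ^ n) (gramSchmidtPolynomial β k) *
      (β (gramSchmidtPolynomial β k) (gramSchmidtPolynomial β k))⁻¹) * gramSchmidtPolynomial β k
decreasing_by all_goals exact k.2

theorem gramSchmidtPolynomial_monic_and_natDegree [NeZero N] (n : ℕ) :
    (gramSchmidtPolynomial β n).Monic ∧ (gramSchmidtPolynomial β n).natDegree = n := by
  induction n using Nat.strong_induction_on with
  | _ n ih =>
    have hlt : (∑ k : Fin n, C (β (X ^ n) (gramSchmidtPolynomial β k) *
      (β (gramSchmidtPolynomial β k) (gramSchmidtPolynomial β k))⁻¹) *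
        gramSchmidtPolynomial β k).degree < (n : WithBot ℕ) := by
      refine (degree_sum_le _ _).trans_lt ((Finset.sup_lt_iff (WithBot.bot_lt_coe n)).2 ?_)
      intro k _
      refine degree_C_mul_lt _ (degree_le_natDegree.trans_lt ?_)
      rw [(ih k k.2).2]
      exact_mod_cast k.2
    rw [gramSchmidtPolynomial]
    refine ⟨(monic_X_pow n).sub_of_left (by rwa [degree_X_pow]), ?_⟩
    exact natDegree_eq_of_degree_eq_some (by
      rw [degree_sub_eq_left_of_degree_lt (by rwa [degree_X_pow]), degree_X_pow])

theorem gramSchmidtPolynomial_orthogonal [NeZero N] (hβ : IsPositiveMatrixForm β) {n m : ℕ}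
    (hmn : m < n) : β (gramSchmidtPolynomial β n) (gramSchmidtPolynomial β m) = 0 := by
  induction n using Nat.strong_induction_on generalizing m with
  | _ n ih =>
    rw [gramSchmidtPolynomial, hβ.sub_left, hβ.sum_left, Finset.sum_eq_single ⟨m, hmn⟩]
    · rw [hβ.C_mul_left, mul_assoc, Matrix.nonsing_inv_mul _ ((Matrix.isUnit_iff_isUnit_det _).1
        (hβ.isUnit_of_monic (gramSchmidtPolynomial_monic_and_natDegree m).1)), mul_one, sub_self]
    · intro k _ hk
      rw [hβ.C_mul_left]
      rcases lt_or_gt_of_ne (fun h => hk (Fin.ext h) : (k : ℕ) ≠ m) with h | h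
      · rw [← hβ.conj_symm (gramSchmidtPolynomial β m), ih m hmn h, Matrix.conjTranspose_zero,
          mul_zero]
      · rw [ih k k.2 h, mul_zero]
    · simp

theorem exists_isMonicOrthogonal [NeZero N] {W : ℝ → Mat N}
    (hβ : IsPositiveMatrixForm (innerW W)) : ∃ P, IsMonicOrthogonal W P := by
  refine ⟨gramSchmidtPolynomial (innerW W),
    fun n => (gramSchmidtPolynomial_monic_and_natDegree n).2,
    fun n => (gramSchmidtPolynomial_monic_and_natDegree n).1, fun n m hmn => ?_⟩
  rcases lt_or_gt_of_ne hmn with h | h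
  · exact gramSchmidtPolynomial_orthogonal hβ h
  · rw [← hβ.conj_symm, gramSchmidtPolynomial_orthogonal hβ h, Matrix.conjTranspose_zero]

namespace IsMonicOrthogonal

variable {W : ℝ → Mat N} {P : ℕ → (Mat N)[X]}

theorem innerW_eq_zero_of_degree_lt (hβ : IsPositiveMatrixForm (innerW W))
    (hP : IsMonicOrthogonal W P) {n : ℕ} {F : (Mat N)[X]} (hF : F.degree < n) :
    innerW W F (P n) = 0 := by
  refine degree_induction hP.natDegree_eq hP.monic (p := fun F => innerW W F (P n) = 0) n
    (hβ.zero_left _) (fun F G hF hG => ?_) (fun a m hm => ?_) F hF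
  · rw [hβ.add_left, hF, hG, add_zero]
  · rw [hβ.C_mul_left, hP.orthogonal m n hm.ne', mul_zero]

theorem eq_zero_of_forall_innerW (hβ : IsPositiveMatrixForm (innerW W))
    (hP : IsMonicOrthogonal W P) {F : (Mat N)[X]} (hF : ∀ n, innerW W F (P n) = 0) : F = 0 := by
  refine hβ.eq_zero_of_forall_right fun G => ?_
  refine monic_basis_induction hP.natDegree_eq hP.monic (p := fun G => innerW W F G = 0)
    (hβ.zero_right _) (fun G K hG hK => ?_) (fun a m => ?_) G
  · rw [hβ.add_right, hG, hK, add_zero]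
  · rw [hβ.C_mul_right, hF, zero_mul]

theorem inv_mul_innerW_self (hβ : IsPositiveMatrixForm (innerW W))
    (hP : IsMonicOrthogonal W P) (n : ℕ) :
    (innerW W (P n) (P n))⁻¹ * innerW W (P n) (P n) = 1 :=
  Matrix.nonsing_inv_mul _ ((Matrix.isUnit_iff_isUnit_det _).1 (hβ.isUnit_of_monic (hP.monic n)))

/-- A polynomial orthogonal to every `P m` with `m ≠ n` is a left multiple of `P n`. -/
theorem exists_eq_C_mul (hβ : IsPositiveMatrixForm (innerW W)) (hP : IsMonicOrthogonal W P)
    {F : (Mat N)[X]} {n : ℕ} (hF : ∀ m, m ≠ n → innerW W F (P m) = 0) :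
    ∃ L : Mat N, F = C L * P n := by
  refine ⟨innerW W F (P n) * (innerW W (P n) (P n))⁻¹, ?_⟩
  rw [← sub_eq_zero]
  refine hP.eq_zero_of_forall_innerW hβ fun m => ?_
  rw [hβ.sub_left, hβ.C_mul_left]
  rcases eq_or_ne m n with rfl | h
  · rw [mul_assoc, hP.inv_mul_innerW_self hβ, mul_one, sub_self]
  · rw [hF m h, hP.orthogonal n m h, mul_zero, sub_zero]

end IsMonicOrthogonal

end MatrixBochner

/-! ### Differential operators and commutators with `x` -/

namespace MatrixBochner

variable {N : ℕ}

theorem act_add (F G : (Mat N)[X]) (D : RightOperator N) :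
    act (F + G) D = act F D + act G D := map_add D.unop F G

theorem act_zero (D : RightOperator N) : act 0 D = 0 := map_zero D.unop

/-- Linearity over the constant matrices acting on the left; every differential operator acting on
the right has this property. -/
def IsLeftLinear (D : RightOperator N) : Prop :=
  ∀ (a : Mat N) (F : (Mat N)[X]), act (C a * F) D = C a * act F D

theorem IsDifferentialOperator.isLeftLinear {D : RightOperator N} (hD : IsDifferentialOperator D) :
    IsLeftLinear D := by
  obtain ⟨l, A, hA⟩ := hD
  intro a F
  simp only [hA, iterate_derivative_C_mul, Finset.mul_sum, mul_assoc]

theorem IsLeftLinear.ext {D E : RightOperator N} (hD : IsLeftLinear D) (hE : IsLeftLinear E)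
    (h : ∀ n, act (X ^ n) D = act (X ^ n) E) : D = E := by
  apply MulOpposite.unop_injective
  apply LinearMap.ext
  intro F
  change act F D = act F E
  induction F using Polynomial.induction_on' with
  | add F G hF hG => rw [act_add, act_add, hF, hG]
  | monomial n a => rw [← C_mul_X_pow_eq_monomial, hD, hE, h]

/-- Multiplication by `x` on matrix polynomials. -/
noncomputable def mulX (N : ℕ) : Module.End ℂ (Mat N)[X] := LinearMap.mulLeft ℂ X

theorem mulX_pow_apply (n : ℕ) (F : (Mat N)[X]) : (mulX N ^ n) F = X ^ n * F := by
  rw [mulX, LinearMap.pow_mulLeft, LinearMap.mulLeft_apply]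

/-- The commutator of an operator with multiplication by `x`. -/
noncomputable def adX (N : ℕ) : Module.End ℂ (Module.End ℂ (Mat N)[X]) where
  toFun := fun T => T * mulX N - mulX N * T
  map_add' := fun S T => LinearMap.ext fun F => by
    change S (X * F) + T (X * F) - X * (S F + T F) = S (X * F) - X * S F + (T (X * F) - X * T F)
    rw [mul_add, add_sub_add_comm]
  map_smul' := fun c T => LinearMap.ext fun F => by
    change c • T (X * F) - X * (c • T F) = c • (T (X * F) - X * T F)
    rw [mul_smul_comm, smul_sub]

theorem adX_apply (T : Module.End ℂ (Mat N)[X]) (F : (Mat N)[X]) :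
    adX N T F = T (X * F) - X * T F := rfl

theorem iterate_derivative_succ_X_mul (j : ℕ) (F : (Mat N)[X]) :
    derivative^[j + 1] (X * F) = X * derivative^[j + 1] F + (j + 1) • derivative^[j] F := by
  induction j with
  | zero => simp [add_comm]
  | succ j ih =>
    rw [Function.iterate_succ_apply', ih, derivative_add, derivative_mul, derivative_X, one_mul,
      derivative_smul, ← Function.iterate_succ_apply' derivative (j + 1),
      ← Function.iterate_succ_apply' derivative j,
      add_smul (j + 1) 1, one_smul]
    abel

theorem adX_pow_term_eq_zero (j : ℕ) (A : (Mat N)[X]) :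
    (adX N ^ (j + 1)) (IsDifferentialOperator.term j A).unop = 0 := by
  induction j with
  | zero =>
    ext1 F
    rw [zero_add, pow_one, adX_apply]
    change X * F * A - X * (F * A) = 0
    rw [mul_assoc, sub_self]
  | succ j ih =>
    have h : adX N (IsDifferentialOperator.term (j + 1) A).unop =
        (j + 1) • (IsDifferentialOperator.term j A).unop := by
      apply LinearMap.ext
      intro F
      rw [adX_apply]
      change act (X * F) (IsDifferentialOperator.term (j + 1) A) -
        X * act F (IsDifferentialOperator.term (j + 1) A) =
        (j + 1) • act F (IsDifferentialOperator.term j A)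
      simp only [IsDifferentialOperator.act_term]
      rw [iterate_derivative_succ_X_mul, add_mul, smul_mul_assoc, mul_assoc, add_sub_cancel_left]
    rw [pow_succ, Module.End.mul_apply, h, map_nsmul, ih, smul_zero]

theorem IsDifferentialOperator.exists_adX_pow_eq_zero {D : RightOperator N}
    (hD : IsDifferentialOperator D) : ∃ m, (adX N ^ m) D.unop = 0 := by
  obtain ⟨l, A, hA⟩ := hD
  refine ⟨l + 1, ?_⟩
  have h : D.unop = ∑ j ∈ Finset.range (l + 1), (IsDifferentialOperator.term j (A j)).unop := by
    apply LinearMap.ext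
    intro F
    rw [LinearMap.sum_apply]
    refine (hA F).trans (Finset.sum_congr rfl fun j _ => ?_)
    exact (IsDifferentialOperator.act_term j (A j) F).symm
  rw [h, map_sum]
  refine Finset.sum_eq_zero fun j hj => ?_
  obtain ⟨i, hi⟩ := Nat.exists_eq_add_of_le' (Nat.succ_le_of_lt (Finset.mem_range.1 hj))
  rw [hi, pow_add, Module.End.mul_apply, adX_pow_term_eq_zero, map_zero]

theorem iterate_derivative_X_pow_eq_nsmul (n j : ℕ) :
    derivative^[j] (X ^ n : (Mat N)[X]) = n.descFactorial j • X ^ (n - j) := by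
  induction j with
  | zero => simp
  | succ j ih =>
    rw [Function.iterate_succ_apply', ih, derivative_smul, derivative_X_pow, Nat.descFactorial_succ,
      Nat.sub_sub, C_eq_natCast, ← nsmul_eq_mul, smul_smul, mul_comm]

/-- Right multiplication by `mulX` is the sum of the commuting operators `adX` and left
multiplication by `mulX`; the formula is the binomial theorem for this sum. -/
theorem apply_X_pow_eq_sum (T : Module.End ℂ (Mat N)[X]) (n : ℕ) :
    T (X ^ n) = ∑ j ∈ Finset.range (n + 1),
      n.choose j • (X ^ (n - j) * (adX N ^ j) T 1) := by
  have hcomm : Commute (adX N) (LinearMap.mulLeft ℂ (mulX N)) :=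
    LinearMap.ext fun S => LinearMap.ext fun F => by
      change X * S (X * F) - X * (X * S F) = X * (S (X * F) - X * S F)
      rw [mul_sub]
  have h : (LinearMap.mulRight ℂ (mulX N)) = adX N + LinearMap.mulLeft ℂ (mulX N) := by
    refine LinearMap.ext fun S => LinearMap.ext fun F => ?_
    change S (X * F) = S (X * F) - X * S F + X * S F
    rw [sub_add_cancel]
  have h1 : T (X ^ n) = (LinearMap.mulRight ℂ (mulX N) ^ n) T 1 := by
    rw [LinearMap.pow_mulRight, LinearMap.mulRight_apply, Module.End.mul_apply, mulX_pow_apply,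
      mul_one]
  rw [h1, h, hcomm.add_pow, LinearMap.sum_apply, LinearMap.sum_apply]
  refine Finset.sum_congr rfl fun j _ => ?_
  rw [(hcomm.pow_pow j (n - j)).eq, ← (Nat.cast_commute (n.choose j) _).eq, ← nsmul_eq_mul,
    LinearMap.smul_apply, LinearMap.smul_apply, Module.End.mul_apply, LinearMap.pow_mulLeft,
    LinearMap.mulLeft_apply, Module.End.mul_apply, mulX_pow_apply]

/-- Differential operators with polynomial coefficients are the left linear operators whose iterated
commutators with `x` vanish eventually; the coefficient of `∂ₓʲ` is `ad(x)ʲ(D)(1) / j!`. -/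
theorem IsLeftLinear.isDifferentialOperator {D : RightOperator N} (hD : IsLeftLinear D) {m : ℕ}
    (hm : (adX N ^ m) D.unop = 0) : IsDifferentialOperator D := by
  have hz : ∀ j, m ≤ j → (adX N ^ j) D.unop = 0 := by
    intro j hj
    obtain ⟨i, rfl⟩ := Nat.exists_eq_add_of_le' hj
    rw [pow_add, Module.End.mul_apply, hm, map_zero]
  refine ⟨m, fun j => ((j.factorial : ℂ)⁻¹) • (adX N ^ j) D.unop 1, fun F => ?_⟩
  have key : ∀ n, act (X ^ n) D = ∑ j ∈ Finset.range (m + 1),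
      derivative^[j] (X ^ n : (Mat N)[X]) * (((j.factorial : ℂ)⁻¹) • (adX N ^ j) D.unop 1) := by
    intro n
    have hterm : ∀ j, derivative^[j] (X ^ n : (Mat N)[X]) *
        (((j.factorial : ℂ)⁻¹) • (adX N ^ j) D.unop 1) =
        n.choose j • (X ^ (n - j) * (adX N ^ j) D.unop 1) := by
      intro j
      rw [iterate_derivative_X_pow_eq_nsmul, Nat.descFactorial_eq_factorial_mul_choose,
        mul_smul_comm, smul_mul_assoc, mul_smul, ← Nat.cast_smul_eq_nsmul ℂ,
        smul_smul, inv_mul_cancel₀ (by exact_mod_cast j.factorial_ne_zero), one_smul]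
    simp only [hterm]
    refine (apply_X_pow_eq_sum D.unop n).trans ?_
    have e1 := Finset.sum_subset (f := fun j => n.choose j • (X ^ (n - j) * (adX N ^ j) D.unop 1))
      (Finset.range_mono (show n + 1 ≤ n + m + 1 by omega)) (fun j _ hj => by
        rw [Nat.choose_eq_zero_of_lt (by simpa using hj), zero_smul])
    have e2 := Finset.sum_subset (f := fun j => n.choose j • (X ^ (n - j) * (adX N ^ j) D.unop 1))
      (Finset.range_mono (show m + 1 ≤ n + m + 1 by omega)) (fun j _ hj => by
        rw [hz j (by have := Finset.mem_range.not.1 hj; omega), LinearMap.zero_apply, mul_zero,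
          smul_zero])
    rw [e1, e2]
  induction F using Polynomial.induction_on' with
  | add F G hF hG =>
    rw [act_add, hF, hG, ← Finset.sum_add_distrib]
    exact Finset.sum_congr rfl fun j _ => by rw [iterate_map_add, add_mul]
  | monomial n a =>
    rw [← C_mul_X_pow_eq_monomial, hD, key, Finset.mul_sum]
    exact Finset.sum_congr rfl fun j _ => by rw [iterate_derivative_C_mul, mul_assoc]

end MatrixBochner

/-! ### Adjoints and reducedness of the center -/

namespace MatrixBochner

variable {N : ℕ} {W : ℝ → Mat N}

/-- As `x` is symmetric, taking adjoints maps commutators with `x` to their negatives. -/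
theorem innerW_adX_pow (hβ : IsPositiveMatrixForm (innerW W)) {S T : Module.End ℂ (Mat N)[X]}
    (h : ∀ F G, innerW W F (S G) = innerW W (T F) G) (m : ℕ) (F G : (Mat N)[X]) :
    innerW W F ((adX N ^ m) S G) = (-1) ^ m * innerW W ((adX N ^ m) T F) G := by
  induction m generalizing F G with
  | zero => simpa using h F G
  | succ m ih =>
    rw [pow_succ' (adX N), Module.End.mul_apply, Module.End.mul_apply, adX_apply, adX_apply,
      hβ.sub_right, hβ.sub_left, ← hβ.X_mul_left, ih, ih, ← hβ.X_mul_left, pow_succ, mul_neg_one,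
      neg_mul, ← mul_neg, ← mul_sub, neg_sub]

theorem adX_pow_eq_zero_of_adjoint (hβ : IsPositiveMatrixForm (innerW W))
    {S T : Module.End ℂ (Mat N)[X]} (h : ∀ F G, innerW W F (S G) = innerW W (T F) G) {m : ℕ}
    (hS : (adX N ^ m) S = 0) : (adX N ^ m) T = 0 := by
  refine LinearMap.ext fun F => hβ.eq_zero_of_forall_right fun G => ?_
  have key := innerW_adX_pow hβ h m F G
  rw [hS, LinearMap.zero_apply, hβ.zero_right] at key
  rcases neg_one_pow_eq_or (Mat N) m with e | e
  · rw [e, one_mul] at key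
    exact key.symm
  · rw [e, neg_one_mul, eq_comm, neg_eq_zero] at key
    exact key

/-- The left `M_N(ℂ)`-linear operator with prescribed values at the powers of `x`. -/
noncomputable def leftLinearExtension (Q : ℕ → (Mat N)[X]) : RightOperator N :=
  MulOpposite.op (Polynomial.lsum fun k =>
    { toFun := fun a => C a * Q k
      map_add' := fun a b => by rw [C_add, add_mul]
      map_smul' := fun c a => by rw [← smul_C, smul_mul_assoc, RingHom.id_apply] })

theorem act_leftLinearExtension_C_mul_X_pow (Q : ℕ → (Mat N)[X]) (a : Mat N) (k : ℕ) :
    act (C a * X ^ k) (leftLinearExtension Q) = C a * Q k := by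
  rw [C_mul_X_pow_eq_monomial]
  exact sum_monomial_index a (fun k a => C a * Q k) (by simp)

theorem act_leftLinearExtension_X_pow (Q : ℕ → (Mat N)[X]) (k : ℕ) :
    act (X ^ k) (leftLinearExtension Q) = Q k := by
  simpa using act_leftLinearExtension_C_mul_X_pow Q 1 k

theorem isLeftLinear_leftLinearExtension (Q : ℕ → (Mat N)[X]) :
    IsLeftLinear (leftLinearExtension Q) := by
  intro a F
  induction F using Polynomial.induction_on' with
  | add F G hF hG => rw [mul_add, act_add, act_add, hF, hG, mul_add]
  | monomial n b =>
    rw [← C_mul_X_pow_eq_monomial, ← mul_assoc, ← C_mul, act_leftLinearExtension_C_mul_X_pow,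
      act_leftLinearExtension_C_mul_X_pow, C_mul, mul_assoc]

/-- The adjoint of an operator `D` having the `P n` as eigenfunctions:
`F ↦ ∑ n, ⟨F, P n · D⟩ ⟨P n, P n⟩⁻¹ P n`. For `F = xᵏ` the terms with `n > k` vanish. -/
noncomputable def adjointOperator (W : ℝ → Mat N) (P : ℕ → (Mat N)[X]) (D : RightOperator N) :
    RightOperator N :=
  leftLinearExtension fun k => ∑ n ∈ Finset.range (k + 1),
    C (innerW W (X ^ k) (act (P n) D) * (innerW W (P n) (P n))⁻¹) * P n

theorem innerW_act_adjointOperator (hβ : IsPositiveMatrixForm (innerW W)) {P : ℕ → (Mat N)[X]}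
    (hP : IsMonicOrthogonal W P) {D : RightOperator N} (hD : IsLeftLinear D)
    (hDP : ∀ n, ∃ L : Mat N, act (P n) D = C L * P n) (F G : (Mat N)[X]) :
    innerW W F (act G D) = innerW W (act F (adjointOperator W P D)) G := by
  have key : ∀ k m, innerW W (X ^ k) (act (P m) D) =
      innerW W (act (X ^ k) (adjointOperator W P D)) (P m) := by
    intro k m
    rw [adjointOperator, act_leftLinearExtension_X_pow, hβ.sum_left]
    have hterm : ∀ n, n ≠ m → innerW W (C (innerW W (X ^ k) (act (P n) D) *
        (innerW W (P n) (P n))⁻¹) * P n) (P m) = 0 := fun n hn => by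
      rw [hβ.C_mul_left, hP.orthogonal n m hn.symm, mul_zero]
    by_cases hm : m ∈ Finset.range (k + 1)
    · rw [Finset.sum_eq_single_of_mem m hm fun n _ hn => hterm n hn, hβ.C_mul_left, mul_assoc,
        hP.inv_mul_innerW_self hβ, mul_one]
    -- For `m > k` both sides vanish, since `P m` is orthogonal to all polynomials of lower degree.
    · rw [Finset.sum_eq_zero fun n hn => hterm n fun h => hm (h ▸ hn)]
      obtain ⟨L, hL⟩ := hDP m
      rw [hL, hβ.C_mul_right, hP.innerW_eq_zero_of_degree_lt hβ, zero_mul]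
      refine (degree_X_pow_le k).trans_lt ?_
      rw [Finset.mem_range] at hm
      exact_mod_cast (by omega : k < m)
  induction F using Polynomial.induction_on' with
  | add F K hF hK => rw [hβ.add_left, act_add, hβ.add_left, hF, hK]
  | monomial k a =>
    have hT : IsLeftLinear (adjointOperator W P D) := isLeftLinear_leftLinearExtension _
    rw [← C_mul_X_pow_eq_monomial, hβ.C_mul_left, hT, hβ.C_mul_left]
    congr 1
    refine monic_basis_induction hP.natDegree_eq hP.monic (p := fun G =>
      innerW W (X ^ k) (act G D) = innerW W (act (X ^ k) (adjointOperator W P D)) G) ?_ ?_ ?_ G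
    · rw [act_zero, hβ.zero_right, hβ.zero_right]
    · intro G K hG hK
      rw [act_add, hβ.add_right, hβ.add_right, hG, hK]
    · intro b m
      rw [hD, hβ.C_mul_right, hβ.C_mul_right, key]

/-- `𝒟(W)` is closed under adjoints. The adjoint exists as a left linear operator because the `P n`
are eigenfunctions, and it is a differential operator because its iterated commutators with `x` are,
up to sign, adjoint to those of `D`. No integration by parts is needed. -/
theorem exists_adjoint_mem_algebraD [NeZero N] (hβ : IsPositiveMatrixForm (innerW W))
    {D : RightOperator N} (hD : D ∈ algebraD W) :
    ∃ T ∈ algebraD W, ∀ F G, innerW W F (act G D) = innerW W (act F T) G := by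
  obtain ⟨P, hP⟩ := exists_isMonicOrthogonal hβ
  have hadj := innerW_act_adjointOperator hβ hP hD.1.isLeftLinear (hD.2 P hP)
  refine ⟨adjointOperator W P D, ⟨?_, ?_⟩, hadj⟩
  · obtain ⟨m, hm⟩ := hD.1.exists_adX_pow_eq_zero
    exact (isLeftLinear_leftLinearExtension _).isDifferentialOperator
      (adX_pow_eq_zero_of_adjoint hβ (T := (adjointOperator W P D).unop) hadj hm)
  · intro Q hQ n
    refine hQ.exists_eq_C_mul hβ fun m hm => ?_
    obtain ⟨L, hL⟩ := hD.2 Q hQ m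
    rw [← hadj, hL, hβ.C_mul_right, hQ.orthogonal n m hm, zero_mul]

/-- A central `D` commutes with its adjoint `T`, so `D² = 0` gives
`⟨F·D·T, F·D·T⟩ = ⟨F·D·T·D, F·D⟩ = 0` and then `⟨F·D, F·D⟩ = ⟨F, F·D·T⟩ = 0`. -/
theorem isReduced_centerZ [NeZero N] (hβ : IsPositiveMatrixForm (innerW W)) :
    IsReduced (centerZ W) := by
  rw [isReduced_iff_pow_one_lt 2 one_lt_two]
  rintro ⟨⟨D, hD⟩, hz⟩ h2
  obtain ⟨T, hT, hadj⟩ := exists_adjoint_mem_algebraD hβ hD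
  have hcomm : ∀ F, act (act F D) T = act (act F T) D := by
    intro F
    have h := Subalgebra.mem_center_iff.1 hz ⟨T, hT⟩
    have h' : T * D = D * T := congrArg Subtype.val h
    exact congrArg (act F) h'.symm
  have hsq : ∀ F, act (act F D) D = 0 := by
    intro F
    have h : D * D = 0 := by
      have := congrArg (fun z : centerZ W => (z.1.1 : RightOperator N)) h2
      rw [pow_two] at this
      exact this
    have h' : act F (D * D) = act F 0 := by rw [h]
    exact h'
  have hadj' : ∀ F G, innerW W (act F D) G = innerW W F (act G T) := fun F G => by
    rw [← hβ.conj_symm, hadj, hβ.conj_symm]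
  have hTD : ∀ F, act (act F D) T = 0 := by
    intro F
    apply hβ.definite
    rw [← hadj, hcomm, hsq, hβ.zero_right]
  have hD0 : ∀ F, act F D = 0 := by
    intro F
    apply hβ.definite
    rw [hadj', hTD, hβ.zero_right]
  have : D = 0 := MulOpposite.unop_injective (LinearMap.ext hD0)
  exact Subtype.ext (Subtype.ext this)

end MatrixBochner

/-! ### The eigenvalue of an operator as a polynomial in `n` -/

namespace MatrixBochner

variable {N : ℕ} {W : ℝ → Mat N}

/-- Operators in `𝒟(W)` do not raise degrees, since they act on each `P n` by a constant matrix. -/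
theorem degree_act_lt [NeZero N] (hβ : IsPositiveMatrixForm (innerW W)) {D : RightOperator N}
    (hD : D ∈ algebraD W) {n : ℕ} {F : (Mat N)[X]} (hF : F.degree < n) :
    (act F D).degree < n := by
  obtain ⟨P, hP⟩ := exists_isMonicOrthogonal hβ
  refine degree_induction hP.natDegree_eq hP.monic (p := fun F => (act F D).degree < n) n
    ?_ (fun F G hF hG => ?_) (fun a m hm => ?_) F hF
  · rw [act_zero, degree_zero]
    exact WithBot.bot_lt_coe n
  · rw [act_add]
    exact (degree_add_le _ _).trans_lt (max_lt hF hG)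
  · obtain ⟨L, hL⟩ := hD.2 P hP m
    rw [hD.1.isLeftLinear, hL]
    refine degree_C_mul_lt _ (degree_C_mul_lt _ (degree_le_natDegree.trans_lt ?_))
    rw [hP.natDegree_eq]
    exact_mod_cast hm

/-- An operator in `𝒟(W)` acts on leading coefficients of degree `n` by right multiplication by the
eigenvalue `Λ(n)`, the coefficient of `xⁿ` in `xⁿ · D`. -/
theorem coeff_act [NeZero N] (hβ : IsPositiveMatrixForm (innerW W)) {D : RightOperator N}
    (hD : D ∈ algebraD W) {n : ℕ} {F : (Mat N)[X]} (hF : F.degree < (n + 1 : ℕ)) :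
    (act F D).coeff n = F.coeff n * (act (X ^ n) D).coeff n := by
  have hlow : (F - C (F.coeff n) * X ^ n).degree < (n : WithBot ℕ) := by
    rw [degree_lt_iff_coeff_zero] at hF ⊢
    intro m hm
    rw [coeff_sub, coeff_C_mul_X_pow]
    rcases hm.eq_or_lt with rfl | hm
    · simp
    · rw [hF m hm, if_neg hm.ne', sub_zero]
  have h := act_add (F - C (F.coeff n) * X ^ n) (C (F.coeff n) * X ^ n) D
  rw [sub_add_cancel, hD.1.isLeftLinear] at h
  rw [h, coeff_add, coeff_C_mul,
    (degree_lt_iff_coeff_zero _ _).1 (degree_act_lt hβ hD hlow) n le_rfl, zero_add]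

/-- The eigenvalue `Λ(n)` is a polynomial in `n`: the sum of `n(n - 1)⋯(n - j + 1)` times the
coefficient of `xʲ` in `A_j`. -/
theorem IsDifferentialOperator.exists_eval_eq_coeff_act {D : RightOperator N}
    (hD : IsDifferentialOperator D) : ∃ M : Matrix (Fin N) (Fin N) ℂ[X],
      ∀ n : ℕ, M.map (Polynomial.eval (n : ℂ)) = (act (X ^ n) D).coeff n := by
  obtain ⟨l, A, hA⟩ := hD
  refine ⟨∑ j ∈ Finset.range (l + 1),
    (descPochhammer ℂ j) • ((A j).coeff j).map Polynomial.C, fun n => ?_⟩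
  have hterm : ∀ j, (derivative^[j] (X ^ n) * A j).coeff n =
      (n.descFactorial j : ℂ) • (A j).coeff j := by
    intro j
    rw [iterate_derivative_X_pow_eq_nsmul, smul_mul_assoc, coeff_smul, Nat.cast_smul_eq_nsmul]
    rcases le_or_gt j n with h | h
    · obtain ⟨i, rfl⟩ := Nat.exists_eq_add_of_le h
      rw [Nat.add_sub_cancel_left, coeff_X_pow_mul]
    · rw [Nat.descFactorial_eq_zero_iff_lt.2 h, zero_smul, zero_smul]
  ext a b
  rw [hA, finsetSum_coeff, Matrix.sum_apply, Matrix.map_apply, Matrix.sum_apply, eval_finsetSum]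
  refine Finset.sum_congr rfl fun j _ => ?_
  rw [hterm, Matrix.smul_apply, Matrix.smul_apply, Matrix.map_apply, smul_eq_mul, eval_mul, eval_C,
    descPochhammer_eval_eq_descFactorial, smul_eq_mul]

theorem matrix_polynomial_ext {M M' : Matrix (Fin N) (Fin N) ℂ[X]}
    (h : ∀ n : ℕ, M.map (Polynomial.eval (n : ℂ)) = M'.map (Polynomial.eval (n : ℂ))) :
    M = M' := by
  ext1 i j
  refine eq_of_infinite_eval_eq _ _ (Set.Infinite.mono ?_
    (Set.infinite_range_of_injective (Nat.cast_injective (R := ℂ))))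
  rintro _ ⟨n, rfl⟩
  exact congrFun (congrFun (h n) i) j

/-- Sending an operator to its eigenvalue `Λ`, a matrix with entries polynomial in `n`, embeds
`𝒟(W)` into the matrices over `ℂ[X]`. The order of factors is kept because operators act on the
right. -/
theorem exists_injective_algHom_matrix [NeZero N] (hβ : IsPositiveMatrixForm (innerW W)) :
    ∃ Λ : algebraD W →ₐ[ℂ] Matrix (Fin N) (Fin N) ℂ[X], Function.Injective Λ := by
  choose M hM using fun D : algebraD W => D.2.1.exists_eval_eq_coeff_act
  have hdeg : ∀ n : ℕ, (X ^ n : (Mat N)[X]).degree < (n + 1 : ℕ) := fun n =>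
    (degree_X_pow_le n).trans_lt (by exact_mod_cast n.lt_succ_self)
  have hmap : ∀ (n : ℕ) (A B : Matrix (Fin N) (Fin N) ℂ[X]), (A * B).map (Polynomial.eval (n : ℂ)) =
      A.map (Polynomial.eval (n : ℂ)) * B.map (Polynomial.eval (n : ℂ)) := fun n A B =>
    Matrix.map_mul (f := Polynomial.evalRingHom (n : ℂ))
  have hone : M 1 = 1 := matrix_polynomial_ext fun n => by
    rw [hM, Matrix.map_one _ (by simp) (by simp)]
    exact coeff_X_pow_self n
  have hadd : ∀ D E, M (D + E) = M D + M E := fun D E => matrix_polynomial_ext fun n => by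
    rw [hM, Matrix.map_add _ (by simp), hM, hM]
    rfl
  have hmul : ∀ D E, M (D * E) = M D * M E := fun D E => matrix_polynomial_ext fun n => by
    rw [hM, hmap, hM, hM]
    refine (coeff_act hβ E.2 (F := act (X ^ n) D.1) ?_)
    exact degree_act_lt hβ D.2 (hdeg n)
  have hsmul : ∀ (c : ℂ) D, M (c • D) = c • M D := fun c D => matrix_polynomial_ext fun n => by
    rw [hM, Matrix.map_smul _ c (by simp), hM]
    rfl
  refine ⟨AlgHom.ofLinearMap ⟨⟨M, hadd⟩, hsmul⟩ hone hmul, ?_⟩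
  intro D E hDE
  have hDE' : M D = M E := hDE
  obtain ⟨P, hP⟩ := exists_isMonicOrthogonal hβ
  have hlead : ∀ (D : algebraD W) n, act (P n) D.1 =
      C ((M D).map (Polynomial.eval (n : ℂ))) * P n := by
    intro D n
    obtain ⟨L, hL⟩ := D.2.2 P hP n
    have h1 := coeff_act hβ D.2 (F := P n) (n := n) (degree_le_natDegree.trans_lt (by
      rw [hP.natDegree_eq]; exact_mod_cast n.lt_succ_self))
    have h2 : (P n).coeff n = 1 := by
      have := (hP.monic n).coeff_natDegree
      rwa [hP.natDegree_eq] at this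
    rw [← hM, hL, coeff_C_mul, h2, mul_one, one_mul] at h1
    rw [hL, h1]
  refine Subtype.ext (MulOpposite.unop_injective (LinearMap.ext fun F => ?_))
  change act F D.1 = act F E.1
  refine monic_basis_induction hP.natDegree_eq hP.monic (p := fun F => act F D.1 = act F E.1)
    (by rw [act_zero, act_zero]) (fun F G hF hG => ?_) (fun a m => ?_) F
  · rw [act_add, act_add, hF, hG]
  · rw [D.2.1.isLeftLinear, E.2.1.isLeftLinear, hlead, hlead, hDE']

end MatrixBochner

theorem mainTheorem6 {N : ℕ} (W : ℝ → MatrixBochner.Mat N) (x₀ x₁ : EReal)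
    (hW : MatrixBochner.IsWeightMatrix W x₀ x₁) :
    IsNoetherianRing (MatrixBochner.centerZ W) ∧
      Algebra.FiniteType ℂ (MatrixBochner.centerZ W) ∧
      ringKrullDim (MatrixBochner.centerZ W) ≤ 1 := by
  rcases Nat.eq_zero_or_pos N with rfl | hN
  -- For `N = 0` the matrix polynomials form the zero ring, and so does the center.
  · have : Subsingleton (MatrixBochner.centerZ W) :=
      ⟨fun z w => Subtype.ext (Subtype.ext (MulOpposite.unop_injective (LinearMap.ext fun F =>
        Subsingleton.elim _ _)))⟩
    refine ⟨inferInstance, ⟨⟨∅, ?_⟩⟩, ?_⟩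
    · ext z
      simp [Subsingleton.elim z 0, zero_mem]
    · rw [ringKrullDim_eq_bot_of_subsingleton]
      exact bot_le
  · have : NeZero N := ⟨hN.ne'⟩
    have hβ := MatrixBochner.isPositiveMatrixForm_innerW hW
    have := MatrixBochner.isReduced_centerZ hβ
    obtain ⟨Λ, hΛ⟩ := MatrixBochner.exists_injective_algHom_matrix hβ
    exact isNoetherianRing_and_finiteType_and_ringKrullDim_le_one
      (Λ.comp (MatrixBochner.centerZ W).val) (hΛ.comp Subtype.val_injective)
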